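/- **Setting.** Let $d,N\ge 1$, $\mathbb T^d_N=\mathbb Z^d/N\mathbb Z^d$, and let $r(x,x+e)>0$ be jump rates attached to the directed edges $(x,e)$, $x\in\mathbb T^d_N$, $e\in\mathbb Z^d$, $|e|=1$ (sums over $e$ below run over the $2d$ vectors $\pm e_1,\dots,\pm e_d$; for $N\le 2$ edges with different directions may share their endpoints). Let $\pi$ be the invariant distribution of the random walk with rates $r$, $\pi[f]=\sum_x\pi(x)f(x)$, $\langle f,h\rangle=\sum_x\pi(x)\overline{f(x)}h(x)$, let $r^*(x,x+e)=\pi(x+e)\,r(x+e,x)/\pi(x)$ be the time-reversed rates (where $r(x+e,x)$ is the rate of the jump $-e$ from $x+e$), and let $$\mathcal Lf(x)=\sum_{e}r(x,x+e)[f(x+e)-f(x)],\qquad \mathcal L^*f(x)=\sum_{e}r^*(x,x+e)[f(x+e)-f(x)]$$ be the generator and its adjoint in $L^2(\pi)$. Put $$c_j(x)=r(x,x+e_j)+r(x,x-e_j),\quad \gamma_j(x)=r(x,x+e_j)-r(x,x-e_j),\quad \Psi(x)=-\sum_{e}\bigl(r^*(x,x+e)+r(x,x+e)\bigr)e .$$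 Fix $\omega\in\mathbb R\setminus\{0\}$ and a unit vector $v\in\mathbb R^d$. For $\lambda\in\mathbb R$ let $(X^\lambda_t)_{t\ge0}$ be the random walk on $\mathbb T^d_N$ which at time $t$ jumps from $x$ to $x+e$ with rate $r^\lambda_t(x,x+e)=e^{\lambda\cos(\omega t)\,e\cdot v}\,r(x,x+e)$, in its oscillatory steady state: the initial distribution is the one, $\pi_\lambda$, that is left invariant by the evolution over one period $2\pi/|\omega|$ (here $\pi$ is the number). Let $(Y^\lambda_t)_{t\ge0}$ be the lift of $(X^\lambda_t)$ to $\mathbb Z^d$ (with any integrable lift $Y^\lambda_0$ of $X^\lambda_0$). **Theorem.** (i) For all $\lambda\in\mathbb R$ and $t\ge0$, $Y^\lambda_t$ is integrable and the mean instantaneous velocity $V_\lambda(t):=\frac{d}{dt}E[Y^\lambda_t]$ (one-sided at $t=0$) exists and equals $\sum_{e}E\bigl[r^\lambda_t(X^\lambda_t,X^\lambda_t+e)\bigr]e$. For every $t\ge0$ the map $\lambda\mapsto V_\lambda(t)$ is differentiable at $\lambda=0$ and $$\partial_{\lambda=0}V_\lambda(t)=\Re\bigl(e^{i\omega t}\sigma(\omega)v\bigr),$$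 where the operator $i\omega-\mathcal L^*$ is invertible and $\sigma(\omega)$ is the complex $d\times d$ matrix (not depending on $v$, $t$) $$\sigma_{jk}(\omega)=\pi[c_j]\,\delta_{jk}+\langle\gamma_j,(i\omega-\mathcal L^*)^{-1}\Psi_k\rangle=\pi[c_j]\,\delta_{jk}+\int_0^{\infty}\langle\gamma_j,e^{-(i\omega-\mathcal L^*)s}\Psi_k\rangle\,ds ,$$ the last integral being absolutely convergent. (ii) If the walk is reversible, i.e. $r^*(x,x+e)=r(x,x+e)$ for all $x,e$, then $\Psi=-2\gamma$, $\mathcal L^*=\mathcal L$, the matrix $\sigma(\omega)$ is symmetric, and $$\sigma_{jk}(\omega)=\pi[c_j]\,\delta_{jk}-2\langle\gamma_j,(i\omega-\mathcal L)^{-1}\gamma_k\rangle=\pi[c_j]\,\delta_{jk}-2\int_0^{\infty}\langle\gamma_j,e^{-(i\omega-\mathcal L)s}\gamma_k\rangle\,ds ,$$ with absolutely convergent integrals. -/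

import Mathlib

open MeasureTheory ProbabilityTheory Set Filter Topology
open scoped NNReal Matrix

namespace TorusWalk

/-- The discrete torus `ℤ^d / N ℤ^d`. -/
abbrev Torus (d N : ℕ) := Fin d → ZMod N

/-- The `2d` directions `e ∈ ℤ^d`, `|e| = 1`: the pair `(j, s)` stands for `s e_j`, `s = ±1`. -/
abbrev Direction (d : ℕ) := Fin d × ℤˣ

/-- The unit vector of `ℤ^d` in a given direction. -/
def Direction.vec {d : ℕ} (e : Direction d) : Fin d → ℤ := Pi.single e.1 (e.2 : ℤ)

/-- The opposite direction `-e`. -/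
def Direction.opp {d : ℕ} (e : Direction d) : Direction d := (e.1, -e.2)

/-- The Euclidean scalar product `e · v`. -/
def Direction.dot {d : ℕ} (e : Direction d) (v : Fin d → ℝ) : ℝ :=
  ∑ i, (e.vec i : ℝ) * v i

/-- The projection `ℤ^d → ℤ^d / N ℤ^d`. -/
def proj {d : ℕ} (N : ℕ) (y : Fin d → ℤ) : Torus d N := fun i => (y i : ZMod N)

/-- The neighbour `x + e` of `x` on the torus. -/
def nbr {d N : ℕ} (x : Torus d N) (e : Direction d) : Torus d N := x + proj N e.vec

/-- Nearest-neighbour jump rates: `r x e` is the rate `r(x, x + e)`. A rate is attached to every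
directed edge; for `N ≥ 3` these are the ordered pairs of neighbouring points. -/
abbrev Rates (d N : ℕ) := Torus d N → Direction d → ℝ

variable {d N : ℕ}

/-- `p` is an invariant probability distribution for the walk with rates `r`. -/
structure IsInvariant [NeZero N] (r : Rates d N) (p : Torus d N → ℝ) : Prop where
  nonneg : ∀ x, 0 ≤ p x
  sum_eq_one : ∑ x, p x = 1
  balance : ∀ x, p x * ∑ e, r x e = ∑ e : Direction d, p (nbr x e) * r (nbr x e) e.opp

/-- The time-reversed rates `r*(x, x + e) = p(x + e) r(x + e, x) / p(x)`. -/
noncomputable def reversed (r : Rates d N) (p : Torus d N → ℝ) : Rates d N :=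
  fun x e => p (nbr x e) * r (nbr x e) e.opp / p x

/-- The walk is reversible with respect to `p` when `r* = r`. -/
def IsReversible (r : Rates d N) (p : Torus d N → ℝ) : Prop := reversed r p = r

/-- The generator `f ↦ ∑_e r(x, x + e) (f(x + e) - f(x))` on complex functions. -/
noncomputable def generator [NeZero N] (r : Rates d N) :
    (Torus d N → ℂ) →L[ℂ] (Torus d N → ℂ) :=
  LinearMap.toContinuousLinearMap
    { toFun := fun f x => ∑ e, (r x e : ℂ) * (f (nbr x e) - f x)
      map_add' := by
        intro f g
        funext x
        simp only [Pi.add_apply, ← Finset.sum_add_distrib]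
        exact Finset.sum_congr rfl fun e _ => by ring
      map_smul' := by
        intro a f
        funext x
        simp only [Pi.smul_apply, smul_eq_mul, RingHom.id_apply, Finset.mul_sum]
        exact Finset.sum_congr rfl fun e _ => by ring }

/-- The adjoint of `generator r` in `L²(p)`, given by the time-reversed rates. -/
noncomputable def adjGenerator [NeZero N] (r : Rates d N) (p : Torus d N → ℝ) :
    (Torus d N → ℂ) →L[ℂ] (Torus d N → ℂ) :=
  generator (reversed r p)

/-- The scalar product of `L²(p)`, conjugate linear in the first argument. -/
noncomputable def scal [NeZero N] (p : Torus d N → ℝ) (f h : Torus d N → ℂ) : ℂ :=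
  ∑ x, (p x : ℂ) * (starRingEnd ℂ (f x) * h x)

/-- `c_j(x) = r(x, x + e_j) + r(x, x - e_j)`. -/
def cFun (r : Rates d N) (j : Fin d) (x : Torus d N) : ℝ := r x (j, 1) + r x (j, -1)

/-- `γ_j(x) = r(x, x + e_j) - r(x, x - e_j)`. -/
def gammaFun (r : Rates d N) (j : Fin d) (x : Torus d N) : ℝ := r x (j, 1) - r x (j, -1)

/-- `Ψ_k(x)`, where `Ψ(x) = - ∑_e (r*(x, x + e) + r(x, x + e)) e`. -/
noncomputable def psiFun (r : Rates d N) (p : Torus d N → ℝ) (k : Fin d) (x : Torus d N) : ℝ :=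
  -∑ e : Direction d, (reversed r p x e + r x e) * (e.vec k : ℝ)

/-- A real function on the torus, seen as a complex one. -/
def toC (f : Torus d N → ℝ) : Torus d N → ℂ := fun x => (f x : ℂ)

/-- The complex mobility matrix
`σ_{jk}(ω) = p[c_j] δ_{jk} + ⟨γ_j, (iω - L*)⁻¹ Ψ_k⟩`. -/
noncomputable def mobility [NeZero N] (r : Rates d N) (p : Torus d N → ℝ) (ω : ℝ) :
    Matrix (Fin d) (Fin d) ℂ :=
  Matrix.of fun j k =>
    (if j = k then ((∑ x, p x * cFun r j x : ℝ) : ℂ) else 0)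
      + scal p (toC (gammaFun r j))
          (resolvent (adjGenerator r p) (Complex.I * (ω : ℂ)) (toC (psiFun r p k)))

/-- The integrand `⟨f, e^{-(iω - A) s} h⟩` for an operator `A`. -/
noncomputable def laplaceIntegrand [NeZero N] (p : Torus d N → ℝ)
    (A : (Torus d N → ℂ) →L[ℂ] (Torus d N → ℂ)) (ω : ℝ) (f h : Torus d N → ℂ) (s : ℝ) : ℂ :=
  scal p f
    (NormedSpace.exp (-((s : ℂ) • (algebraMap ℂ _ (Complex.I * (ω : ℂ)) - A))) h)

/-- The perturbed rates `r_t^l(x, x + e) = exp(l cos(ω t) e · v) r(x, x + e)`. -/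
noncomputable def perturbed (r : Rates d N) (ω : ℝ) (v : Fin d → ℝ) (l t : ℝ) : Rates d N :=
  fun x e => Real.exp (l * Real.cos (ω * t) * e.dot v) * r x e

/-- The generator at time `t` of the perturbed walk lifted to `ℤ^d`. -/
noncomputable def liftedGenerator (r : Rates d N) (ω : ℝ) (v : Fin d → ℝ) (l t : ℝ)
    (f : (Fin d → ℤ) → ℝ) (y : Fin d → ℤ) : ℝ :=
  ∑ e : Direction d, perturbed r ω v l t (proj N y) e * (f (y + e.vec) - f y)

/-- `Y` is (the lift to `ℤ^d` of) the perturbed random walk: a càdlàg process which is a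
time-inhomogeneous Markov jump process jumping from `y` to `y + e` at time `t` with rate
`r_t^l(y, y + e)`, where `y` is read modulo `N`. The law of the process is
specified by its martingale problem (the rates are bounded). -/
structure IsLiftedWalk (r : Rates d N) (ω : ℝ) (v : Fin d → ℝ) (l : ℝ)
    {Ω : Type*} [mΩ : MeasurableSpace Ω] (P : Measure Ω) (Y : ℝ≥0 → Ω → Fin d → ℤ) : Prop where
  right_continuous : ∀ a t, ContinuousWithinAt (fun s => Y s a) (Ici t) t
  left_limits : ∀ a t, ∃ y, Tendsto (fun s => Y s a) (𝓝[<] t) (𝓝 y)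
  martingale_problem : ∃ ℱ : Filtration ℝ≥0 mΩ, (∀ t, Measurable[ℱ t] (Y t)) ∧
    ∀ f : (Fin d → ℤ) → ℝ, (∃ C, ∀ y, |f y| ≤ C) →
      Martingale (fun (t : ℝ≥0) a => f (Y t a)
        - ∫ s in (0 : ℝ)..t, liftedGenerator r ω v l s f (Y s.toNNReal a)) ℱ P

/-- The perturbed walk in its oscillatory steady state: the torus walk `X_t = Y_t mod N` starts
from a distribution that is left invariant by the evolution over one period `2π / |ω|`. The
starting point in `ℤ^d` may be any integrable lift of `X_0`. -/
structure IsOscillatorySteadyState (r : Rates d N) (ω : ℝ) (v : Fin d → ℝ) (l : ℝ)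
    {Ω : Type*} [MeasurableSpace Ω] (P : Measure Ω) (Y : ℝ≥0 → Ω → Fin d → ℤ) : Prop where
  walk : IsLiftedWalk r ω v l P Y
  integrable_start : ∀ j, Integrable (fun a => (Y 0 a j : ℝ)) P
  periodic : ∀ x : Torus d N,
    P {a | proj N (Y (2 * Real.pi / |ω|).toNNReal a) = x} = P {a | proj N (Y 0 a) = x}

/-- The mean position `E[Y_t]`, for `t ≥ 0`. -/
noncomputable def meanPosition {Ω : Type*} [MeasurableSpace Ω] (P : Measure Ω)
    (Y : ℝ≥0 → Ω → Fin d → ℤ) (t : ℝ) : Fin d → ℝ :=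
  fun j => ∫ a, (Y t.toNNReal a j : ℝ) ∂P

/-- The mean instantaneous velocity `d/dt E[Y_t]` (one-sided at `t = 0`). -/
noncomputable def meanVelocity {Ω : Type*} [MeasurableSpace Ω] (P : Measure Ω)
    (Y : ℝ≥0 → Ω → Fin d → ℤ) (t : ℝ) : Fin d → ℝ :=
  derivWithin (meanPosition P Y) (Ici 0) t

end TorusWalk

namespace TorusWalk

variable {d N : ℕ}

/-! ### Directions and the torus -/

/-! Let `h_t` be the density with respect to `π` of the law of `X_t`. The forward equation reads `h'
= L* h + F_t h`, where `F_t` (`forcing`) is of order `λ` and `F_t 1 = λ cos(ωt) Ψ·v + O(λ²)`. Since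
`1` is the steady density at `λ = 0`, the first-order term should solve `u' = L* u + cos(ωt) Ψ·v`;
the solution of mean zero and period `T = 2π/|ω|` is `u_t = Re(e^{iωt} (iω - L*)⁻¹ Ψ·v)`
(`response`).

One estimate makes this rigorous, `exists_periodic_bound`: a mean-zero solution of `k' = L* k + g`
with `k_T = k_0` is bounded by a constant times `sup ‖g‖`. The Poincaré inequality makes `L*`
dissipative on mean-zero functions, and the equality of the values at `0` and `T` eliminates the
initial condition. Applied to `h - 1` the estimate gives `O(λ)`; applied to `h - 1 - λu` it then
gives `O(λ²)`. No prior regularity of `π_λ` in `λ` is needed.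

The velocity is the perturbed drift summed against the law. By the product rule the derivative of
the rates contributes `cos(ωt) π[c_j] v_j`, and that of the law contributes `⟨γ_j, u_t⟩`. The
Poincaré inequality also makes the semigroup decay exponentially on mean-zero functions, which turns
the resolvent into a Laplace transform.

The martingale problem enters through Dynkin's formula only: indicators of torus points give the
forward equation, truncated coordinates give integrability and the mean position. -/

theorem Direction.opp_opp (e : Direction d) : e.opp.opp = e := by
  simp [Direction.opp]

theorem Direction.vec_opp (e : Direction d) : e.opp.vec = -e.vec := by
  simp [Direction.opp, Direction.vec, ← Pi.single_neg]

theorem Direction.dot_opp (e : Direction d) (v : Fin d → ℝ) : e.opp.dot v = -e.dot v := by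
  simp [Direction.dot, Direction.vec_opp]

theorem Direction.dot_eq (e : Direction d) (v : Fin d → ℝ) :
    e.dot v = ((e.2 : ℤ) : ℝ) * v e.1 := by
  unfold Direction.dot Direction.vec
  rw [Finset.sum_eq_single e.1]
  · simp
  · intro i _ hi
    simp [Pi.single_eq_of_ne hi]
  · simp

theorem Direction.abs_dot_le_one (e : Direction d) (v : Fin d → ℝ) (hv : ∑ i, v i ^ 2 = 1) :
    |e.dot v| ≤ 1 := by
  have h1 : v e.1 ^ 2 ≤ 1 := by
    rw [← hv]
    exact Finset.single_le_sum (f := fun i => v i ^ 2) (fun i _ => sq_nonneg _) (Finset.mem_univ _)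
  have h2 : |v e.1| ≤ 1 := by
    rw [← sq_abs] at h1
    nlinarith [abs_nonneg (v e.1)]
  rw [Direction.dot_eq]
  rcases Int.units_eq_one_or e.2 with h | h <;> simpa [h] using h2

theorem proj_add (y z : Fin d → ℤ) : proj N (y + z) = proj N y + proj N z := by
  funext i; simp [proj]

theorem proj_neg (y : Fin d → ℤ) : proj N (-y) = -proj N y := by
  funext i; simp [proj]

theorem proj_add_vec (y : Fin d → ℤ) (e : Direction d) :
    proj N (y + e.vec) = nbr (proj N y) e := proj_add _ _

theorem nbr_nbr_opp (x : Torus d N) (e : Direction d) : nbr (nbr x e) e.opp = x := by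
  simp [nbr, Direction.vec_opp, proj_neg]

/-- Reversal of the directed edges: `(x, e) ↦ (x + e, -e)`. -/
def edgeReversal : Torus d N × Direction d ≃ Torus d N × Direction d where
  toFun a := (nbr a.1 a.2, a.2.opp)
  invFun a := (nbr a.1 a.2, a.2.opp)
  left_inv a := by simp [nbr_nbr_opp, Direction.opp_opp]
  right_inv a := by simp [nbr_nbr_opp, Direction.opp_opp]

/-- This is the summation by parts used throughout. Labelling edges by direction keeps the reversal
a bijection also for `N ≤ 2`. -/
theorem sum_edgeReversal [NeZero N] {A : Type*} [AddCommMonoid A]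
    (F : Torus d N → Direction d → A) :
    ∑ x, ∑ e : Direction d, F (nbr x e) e.opp = ∑ x, ∑ e, F x e := by
  rw [← Fintype.sum_prod_type', ← Fintype.sum_prod_type']
  exact Equiv.sum_comp edgeReversal (fun a => F a.1 a.2)

theorem sum_direction {A : Type*} [AddCommMonoid A] (F : Direction d → A) :
    ∑ e, F e = ∑ j, (F (j, 1) + F (j, -1)) := by
  rw [Fintype.sum_prod_type]
  refine Finset.sum_congr rfl fun j _ => ?_
  rw [show (Finset.univ : Finset ℤˣ) = {1, -1} from rfl, Finset.sum_pair (by decide)]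

/-- The torus is connected. -/
theorem forall_of_nbr [NeZero N] {S : Torus d N → Prop} {x₀ : Torus d N} (h₀ : S x₀)
    (h : ∀ x (e : Direction d), S x → S (nbr x e)) (x : Torus d N) : S x := by
  have key : ∀ z : Torus d N, ∀ y, S y → S (y + z) := by
    intro z
    rw [← Finset.univ_sum_single z]
    generalize (Finset.univ : Finset (Fin d)) = s
    induction s using Finset.induction_on with
    | empty => intro y hy; simpa using hy
    | insert i s hi ih =>
      intro y hy
      rw [Finset.sum_insert hi, ← add_assoc]
      refine ih _ ?_
      -- Steps in the positive direction suffice, because every class modulo `N` has a natural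
      -- representative.
      have hn : ∀ n : ℕ, S (y + Pi.single i (n : ZMod N)) := by
        intro n
        induction n with
        | zero => simpa using hy
        | succ n ihn =>
          have h1 := h _ (i, 1) ihn
          convert h1 using 1
          funext k
          by_cases hk : k = i
          · subst hk; simp [nbr, proj, Direction.vec, add_assoc]
          · simp [nbr, proj, Direction.vec, Pi.single_eq_of_ne hk]
      have := hn (z i).val
      rwa [ZMod.natCast_zmod_val] at this
  have := key (x - x₀) x₀ h₀
  simpa using this

/-! ### The invariant distribution and the reversed rates -/

section

variable [NeZero N] {r : Rates d N} {p : Torus d N → ℝ}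

/-- If `p` vanishes at a point, the balance equation there forces it to vanish at all neighbours,
hence everywhere by connectedness, against total mass one. -/
theorem IsInvariant.pos (hr : ∀ x e, 0 < r x e) (hp : IsInvariant r p) (x : Torus d N) :
    0 < p x := by
  by_contra hx
  have hx0 : p x = 0 := le_antisymm (not_lt.1 hx) (hp.nonneg x)
  have hall : ∀ y, p y = 0 := by
    refine forall_of_nbr (S := fun y => p y = 0) hx0 fun y e hy => ?_
    have hb := hp.balance y
    rw [hy, zero_mul] at hb
    have h0 := (Finset.sum_eq_zero_iff_of_nonneg
      (fun e _ => mul_nonneg (hp.nonneg _) (hr _ _).le)).1 hb.symm e (Finset.mem_univ _)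
    exact (mul_eq_zero.1 h0).resolve_right (hr _ _).ne'
  have := hp.sum_eq_one
  simp [hall] at this

omit [NeZero N] in
theorem mul_reversed (hp0 : ∀ x, 0 < p x) (x : Torus d N) (e : Direction d) :
    p x * reversed r p x e = p (nbr x e) * r (nbr x e) e.opp := by
  unfold reversed
  field_simp [(hp0 x).ne']

/-- The balance equation divided by `p x`. It allows the diagonal terms of `L*` to be written with
the original rates. -/
theorem sum_reversed (hp0 : ∀ x, 0 < p x) (hp : IsInvariant r p) (x : Torus d N) :
    ∑ e, reversed r p x e = ∑ e, r x e := by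
  have h := hp.balance x
  have h2 : p x * ∑ e, reversed r p x e = p x * ∑ e, r x e := by
    rw [h, Finset.mul_sum]
    exact Finset.sum_congr rfl fun e _ => mul_reversed hp0 x e
  exact mul_left_cancel₀ (hp0 x).ne' h2

theorem generator_apply (r : Rates d N) (f : Torus d N → ℂ) (x : Torus d N) :
    generator r f x = ∑ e, (r x e : ℂ) * (f (nbr x e) - f x) := rfl

theorem adjGenerator_apply (r : Rates d N) (p : Torus d N → ℝ) (f : Torus d N → ℂ)
    (x : Torus d N) :
    adjGenerator r p f x = ∑ e, (reversed r p x e : ℂ) * (f (nbr x e) - f x) := rfl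

/-- The mean of a complex function. -/
noncomputable def mean (p : Torus d N → ℝ) (f : Torus d N → ℂ) : ℂ := ∑ x, (p x : ℂ) * f x

/-- The squared norm in `L²(p)`. -/
noncomputable def energy (p : Torus d N → ℝ) (f : Torus d N → ℂ) : ℝ :=
  ∑ x, p x * ‖f x‖ ^ 2

/-- Twice the Dirichlet form. -/
noncomputable def dirichlet (r : Rates d N) (p : Torus d N → ℝ) (f : Torus d N → ℂ) : ℝ :=
  ∑ x, ∑ e, p x * reversed r p x e * ‖f (nbr x e) - f x‖ ^ 2

/-- Gain and loss terms are exchanged by edge reversal once the total exit rates of `r*` and `r` are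
identified. -/
theorem mean_adjGenerator (hp0 : ∀ x, 0 < p x) (hp : IsInvariant r p) (f : Torus d N → ℂ) :
    mean p (adjGenerator r p f) = 0 := by
  have h1 : mean p (adjGenerator r p f) =
      ∑ x, ∑ e : Direction d, ((p (nbr x e) : ℂ) * r (nbr x e) e.opp * f (nbr x e))
        - ∑ x, ∑ e, (p x : ℂ) * r x e * f x := by
    rw [← Finset.sum_sub_distrib]
    refine Finset.sum_congr rfl fun x _ => ?_
    have hs : ∑ e, (p x : ℂ) * r x e * f x = ∑ e, (p x : ℂ) * reversed r p x e * f x := by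
      rw [← Finset.sum_mul, ← Finset.sum_mul, ← Finset.mul_sum, ← Finset.mul_sum]
      have := sum_reversed hp0 hp x
      congr 2
      exact_mod_cast this.symm
    rw [hs, ← Finset.sum_sub_distrib, adjGenerator_apply, Finset.mul_sum]
    refine Finset.sum_congr rfl fun e _ => ?_
    have := mul_reversed (r := r) hp0 x e
    rw [← Complex.ofReal_mul (p (nbr x e)), ← this]
    push_cast
    ring
  rw [h1, sum_edgeReversal (fun x e => (p x : ℂ) * r x e * f x), sub_self]

/-- Pointwise `2 Re(ā(b - a)) = |b|² - |a|² - |b - a|²`. The first two terms cancel by stationarity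
and the last one gives the Dirichlet form, so reversibility plays no role. -/
theorem two_re_adjGenerator (hp0 : ∀ x, 0 < p x) (hp : IsInvariant r p) (f : Torus d N → ℂ) :
    ∑ x, p x * (2 * (starRingEnd ℂ (f x) * adjGenerator r p f x).re) = -dirichlet r p f := by
  have h1 : ∀ x (e : Direction d), 2 * (starRingEnd ℂ (f x) * (f (nbr x e) - f x)).re =
      ‖f (nbr x e)‖ ^ 2 - ‖f x‖ ^ 2 - ‖f (nbr x e) - f x‖ ^ 2 := by
    intro x e
    simp only [← Complex.normSq_eq_norm_sq, Complex.normSq_apply, Complex.mul_re, Complex.sub_re,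
      Complex.sub_im, Complex.conj_re, Complex.conj_im]
    ring
  have h2 : ∀ x, p x * (2 * (starRingEnd ℂ (f x) * adjGenerator r p f x).re) =
      ∑ e : Direction d, p (nbr x e) * r (nbr x e) e.opp * ‖f (nbr x e)‖ ^ 2
        - ∑ e, p x * r x e * ‖f x‖ ^ 2
        - ∑ e, p x * reversed r p x e * ‖f (nbr x e) - f x‖ ^ 2 := by
    intro x
    have hs : ∑ e, p x * r x e * ‖f x‖ ^ 2 = ∑ e, p x * reversed r p x e * ‖f x‖ ^ 2 := by
      rw [← Finset.sum_mul, ← Finset.sum_mul, ← Finset.mul_sum, ← Finset.mul_sum,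
        sum_reversed hp0 hp x]
    rw [hs, adjGenerator_apply, Finset.mul_sum, Complex.re_sum, Finset.mul_sum, Finset.mul_sum,
      ← Finset.sum_sub_distrib, ← Finset.sum_sub_distrib]
    refine Finset.sum_congr rfl fun e _ => ?_
    rw [← mul_reversed hp0]
    have h3 : (starRingEnd ℂ (f x) * ((reversed r p x e : ℂ) * (f (nbr x e) - f x))).re =
        reversed r p x e * (starRingEnd ℂ (f x) * (f (nbr x e) - f x)).re := by
      rw [mul_left_comm, Complex.re_ofReal_mul]
    rw [h3]
    linear_combination (p x * reversed r p x e) * h1 x e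
  rw [Finset.sum_congr rfl fun x _ => h2 x, Finset.sum_sub_distrib, Finset.sum_sub_distrib,
    sum_edgeReversal (fun x e => p x * r x e * ‖f x‖ ^ 2), sub_self, zero_sub]
  rfl

omit [NeZero N] in
theorem reversed_pos (hr : ∀ x e, 0 < r x e) (hp0 : ∀ x, 0 < p x) (x : Torus d N)
    (e : Direction d) : 0 < reversed r p x e :=
  div_pos (mul_pos (hp0 _) (hr _ _)) (hp0 _)

theorem dirichlet_nonneg (hr : ∀ x e, 0 < r x e) (hp0 : ∀ x, 0 < p x) (f : Torus d N → ℂ) :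
    0 ≤ dirichlet r p f :=
  Finset.sum_nonneg fun x _ => Finset.sum_nonneg fun e _ =>
    mul_nonneg (mul_nonneg (hp0 x).le (reversed_pos hr hp0 x e).le) (sq_nonneg _)

theorem eq_of_dirichlet_eq_zero (hr : ∀ x e, 0 < r x e) (hp0 : ∀ x, 0 < p x)
    {f : Torus d N → ℂ} (hf : dirichlet r p f = 0) (x y : Torus d N) : f x = f y := by
  have hnn : ∀ x (e : Direction d), 0 ≤ p x * reversed r p x e * ‖f (nbr x e) - f x‖ ^ 2 :=
    fun x e => mul_nonneg (mul_nonneg (hp0 x).le (reversed_pos hr hp0 x e).le) (sq_nonneg _)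
  refine forall_of_nbr (S := fun z => f z = f y) (x₀ := y) rfl (fun z e hz => ?_) x
  have h1 := (Finset.sum_eq_zero_iff_of_nonneg
    (fun x _ => Finset.sum_nonneg fun e _ => hnn x e)).1 hf z (Finset.mem_univ _)
  have h2 := (Finset.sum_eq_zero_iff_of_nonneg (fun e _ => hnn z e)).1 h1 e (Finset.mem_univ _)
  have h3 : ‖f (nbr z e) - f z‖ ^ 2 = 0 :=
    (mul_eq_zero.1 h2).resolve_left (mul_pos (hp0 z) (reversed_pos hr hp0 z e)).ne'
  have h4 : f (nbr z e) - f z = 0 := by simpa using h3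
  rw [sub_eq_zero.1 h4, hz]

/-! ### Comparison of norms and spectral gap. -/

theorem energy_le_norm_sq (hp : IsInvariant r p) (f : Torus d N → ℂ) :
    energy p f ≤ ‖f‖ ^ 2 := by
  have : ∑ x, p x * ‖f x‖ ^ 2 ≤ ∑ x, p x * ‖f‖ ^ 2 := by
    refine Finset.sum_le_sum fun x _ => mul_le_mul_of_nonneg_left ?_ (hp.nonneg x)
    exact pow_le_pow_left₀ (norm_nonneg _) (norm_le_pi_norm f x) 2
  rwa [← Finset.sum_mul, hp.sum_eq_one, one_mul] at this

theorem energy_nonneg (hp0 : ∀ x, 0 < p x) (f : Torus d N → ℂ) : 0 ≤ energy p f :=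
  Finset.sum_nonneg fun x _ => mul_nonneg (hp0 x).le (sq_nonneg _)

/-- The constant is the minimum of `p`; it converts energy estimates into sup-norm estimates. -/
theorem exists_norm_sq_le_energy (hp0 : ∀ x, 0 < p x) :
    ∃ m : ℝ, 0 < m ∧ (∀ x, m ≤ p x) ∧ ∀ f : Torus d N → ℂ, m * ‖f‖ ^ 2 ≤ energy p f := by
  obtain ⟨x₀, hx₀⟩ := Finite.exists_min p
  refine ⟨p x₀, hp0 x₀, hx₀, fun f => ?_⟩
  have h1 : ∀ x, p x₀ * ‖f x‖ ^ 2 ≤ energy p f := fun x =>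
    (mul_le_mul_of_nonneg_right (hx₀ x) (sq_nonneg _)).trans
      (Finset.single_le_sum (f := fun x => p x * ‖f x‖ ^ 2)
        (fun x _ => mul_nonneg (hp0 x).le (sq_nonneg _)) (Finset.mem_univ x))
  have h2 : ‖f‖ ≤ Real.sqrt (energy p f / p x₀) := by
    refine (pi_norm_le_iff_of_nonneg (Real.sqrt_nonneg _)).2 fun x => Real.le_sqrt_of_sq_le ?_
    rw [le_div_iff₀ (hp0 x₀), mul_comm]
    exact h1 x
  have h4 : ‖f‖ ^ 2 ≤ energy p f / p x₀ := by
    have := pow_le_pow_left₀ (norm_nonneg _) h2 2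
    rwa [Real.sq_sqrt (div_nonneg (energy_nonneg hp0 f) (hp0 x₀).le)] at this
  rwa [le_div_iff₀ (hp0 x₀), mul_comm] at h4

theorem mean_sub (p : Torus d N → ℝ) (f g : Torus d N → ℂ) :
    mean p (f - g) = mean p f - mean p g := by
  simp [mean, mul_sub, Finset.sum_sub_distrib]

theorem mean_smul (p : Torus d N → ℝ) (a : ℂ) (f : Torus d N → ℂ) :
    mean p (a • f) = a * mean p f := by
  simp [mean, Finset.mul_sum, mul_left_comm]

theorem mean_one (hp : IsInvariant r p) : mean p 1 = 1 := by
  have := hp.sum_eq_one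
  simp only [mean, Pi.one_apply, mul_one]
  exact_mod_cast this

/-- The Poincaré inequality. -/
theorem exists_poincare (hr : ∀ x e, 0 < r x e) (hp0 : ∀ x, 0 < p x) (hp : IsInvariant r p) :
    ∃ κ : ℝ, 0 < κ ∧ ∀ f : Torus d N → ℂ, mean p f = 0 → κ * energy p f ≤ dirichlet r p f := by
  have hcm : Continuous (mean p : (Torus d N → ℂ) → ℂ) := by unfold mean; fun_prop
  have hcd : Continuous (dirichlet r p : (Torus d N → ℂ) → ℝ) := by unfold dirichlet; fun_prop
  -- Compactness argument: on the mean-zero part of the unit sphere the Dirichlet form attains its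
  -- minimum. The minimum is positive, since a zero of the form is constant and a mean-zero constant
  -- is `0`.
  have hK : IsCompact (Metric.sphere (0 : Torus d N → ℂ) 1 ∩ {f | mean p f = 0}) :=
    (isCompact_sphere 0 1).inter_right (isClosed_eq hcm continuous_const)
  have hconst : ∀ f : Torus d N → ℂ, mean p f = 0 → dirichlet r p f = 0 → f = 0 := by
    intro f hm hd
    funext x
    have h1 : f = f x • (1 : Torus d N → ℂ) := by
      funext y; simpa using eq_of_dirichlet_eq_zero hr hp0 hd y x
    rw [h1, mean_smul, mean_one hp, mul_one] at hm
    exact hm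
  have hscale : ∀ (a : ℝ) (f : Torus d N → ℂ),
      dirichlet r p ((a : ℂ) • f) = a ^ 2 * dirichlet r p f := by
    intro a f
    simp only [dirichlet, Finset.mul_sum, Pi.smul_apply, ← smul_sub, norm_smul, mul_pow]
    refine Finset.sum_congr rfl fun x _ => Finset.sum_congr rfl fun e _ => ?_
    simp only [Complex.norm_real, Real.norm_eq_abs, sq_abs]
    ring
  obtain hne | hne :=
    (Metric.sphere (0 : Torus d N → ℂ) 1 ∩ {f | mean p f = 0}).eq_empty_or_nonempty
  -- An empty slice means that `0` is the only mean-zero function, as on a one-point torus; any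
  -- constant then works.
  · refine ⟨1, one_pos, fun f hf => ?_⟩
    have hf0 : f = 0 := by
      by_contra hf0
      have : ((‖f‖⁻¹ : ℝ) : ℂ) • f ∈ (∅ : Set (Torus d N → ℂ)) := by
        rw [← hne]
        refine ⟨?_, ?_⟩
        · simp [norm_smul, norm_ne_zero_iff.2 hf0]
        · simp [mean_smul, hf]
      exact this
    subst hf0
    simpa [energy] using dirichlet_nonneg hr hp0 (0 : Torus d N → ℂ)
  · obtain ⟨f₀, hf₀, hmin⟩ := hK.exists_isMinOn hne hcd.continuousOn
    have hδ : 0 < dirichlet r p f₀ := by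
      refine lt_of_le_of_ne (dirichlet_nonneg hr hp0 f₀) fun h0 => ?_
      have := hconst f₀ hf₀.2 h0.symm
      have h1 := hf₀.1
      simp [this] at h1
    refine ⟨_, hδ, fun f hf => ?_⟩
    refine (mul_le_mul_of_nonneg_left (energy_le_norm_sq hp f) hδ.le).trans ?_
    by_cases hf0 : f = 0
    · subst hf0
      simpa using dirichlet_nonneg hr hp0 (0 : Torus d N → ℂ)
    · have hn : ‖f‖ ≠ 0 := norm_ne_zero_iff.2 hf0
      have h1 : dirichlet r p f₀ ≤ dirichlet r p (((‖f‖⁻¹ : ℝ) : ℂ) • f) := by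
        refine hmin ⟨?_, ?_⟩
        · simp [norm_smul, hn]
        · simp [mean_smul, hf]
      rw [hscale] at h1
      calc dirichlet r p f₀ * ‖f‖ ^ 2 ≤ (‖f‖⁻¹ ^ 2 * dirichlet r p f) * ‖f‖ ^ 2 :=
            mul_le_mul_of_nonneg_right h1 (sq_nonneg _)
        _ = dirichlet r p f := by field_simp

/-- The operator `iω - L*` is invertible. -/
theorem mem_resolventSet_adjGenerator (hr : ∀ x e, 0 < r x e) (hp0 : ∀ x, 0 < p x)
    (hp : IsInvariant r p) {ω : ℝ} (hω : ω ≠ 0) :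
    Complex.I * (ω : ℂ) ∈ resolventSet ℂ (adjGenerator r p) := by
  change IsUnit _
  set T := algebraMap ℂ ((Torus d N → ℂ) →L[ℂ] (Torus d N → ℂ)) (Complex.I * (ω : ℂ))
    - adjGenerator r p with hT
  -- In finite dimension injectivity suffices. If `L* f = iω f`, then `f̄ L* f` is purely imaginary,
  -- so the Dirichlet form of `f` vanishes; `f` is constant, hence `iω f = L* f = 0`.
  have hinj : Function.Injective T := by
    rw [injective_iff_map_eq_zero]
    intro f hf
    have h1 : adjGenerator r p f = (Complex.I * (ω : ℂ)) • f := by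
      have : (Complex.I * (ω : ℂ)) • f - adjGenerator r p f = 0 := by
        simpa [hT, Algebra.algebraMap_eq_smul_one] using hf
      exact (sub_eq_zero.1 this).symm
    have h2 := two_re_adjGenerator hp0 hp f
    have h3 : ∀ x, (starRingEnd ℂ (f x) * adjGenerator r p f x).re = 0 := by
      intro x
      rw [h1]
      simp only [Pi.smul_apply, smul_eq_mul, Complex.mul_re, Complex.mul_im, Complex.conj_re,
        Complex.conj_im, Complex.I_re, Complex.I_im, Complex.ofReal_re, Complex.ofReal_im]
      ring
    simp only [h3, mul_zero, Finset.sum_const_zero] at h2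
    have hd : dirichlet r p f = 0 := by linarith
    have h4 : adjGenerator r p f = 0 := by
      funext x
      rw [adjGenerator_apply]
      refine Finset.sum_eq_zero fun e _ => ?_
      rw [eq_of_dirichlet_eq_zero hr hp0 hd (nbr x e) x, sub_self, mul_zero]
    rw [h4] at h1
    refine (smul_eq_zero.1 h1.symm).resolve_left ?_
    simp [hω]
  have hu : IsUnit (T : (Torus d N → ℂ) →ₗ[ℂ] (Torus d N → ℂ)) :=
    (LinearMap.isUnit_iff_ker_eq_bot _).2 (LinearMap.ker_eq_bot.2 hinj)
  rw [ContinuousLinearMap.isUnit_iff_bijective]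
  exact (Module.End.isUnit_iff _).1 hu

/-! ### The resolvent and functions of mean zero. -/

omit [NeZero N] in
theorem resolvent_equation {A : (Torus d N → ℂ) →L[ℂ] (Torus d N → ℂ)} {z : ℂ}
    (hz : z ∈ resolventSet ℂ A) (f : Torus d N → ℂ) :
    z • resolvent A z f - A (resolvent A z f) = f := by
  have h : (algebraMap ℂ _ z - A) * resolvent A z = 1 := Ring.mul_inverse_cancel _ hz
  have := congrArg (fun B => B f) h
  simpa [Algebra.algebraMap_eq_smul_one] using this

theorem mean_resolvent (hp0 : ∀ x, 0 < p x) (hp : IsInvariant r p) {z : ℂ} (hz0 : z ≠ 0)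
    (hz : z ∈ resolventSet ℂ (adjGenerator r p)) {f : Torus d N → ℂ} (hf : mean p f = 0) :
    mean p (resolvent (adjGenerator r p) z f) = 0 := by
  have h := congrArg (mean p) (resolvent_equation hz f)
  rw [mean_sub, mean_smul, mean_adjGenerator hp0 hp, sub_zero, hf] at h
  exact (mul_eq_zero.1 h).resolve_left hz0

/-- The `r*` part and the `r` part of `p Ψ_k` are exchanged by edge reversal with opposite signs.
This puts `Ψ_k` in the space where the Poincaré inequality applies. -/
theorem mean_psiFun (hp0 : ∀ x, 0 < p x) (k : Fin d) : mean p (toC (psiFun r p k)) = 0 := by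
  have h : ∑ x, p x * psiFun r p k x = 0 := by
    have h1 : ∀ x, p x * psiFun r p k x =
        ∑ e : Direction d, p (nbr x e) * r (nbr x e) e.opp * (e.opp.vec k : ℝ)
          - ∑ e, p x * r x e * (e.vec k : ℝ) := by
      intro x
      rw [← Finset.sum_sub_distrib, psiFun, mul_neg, Finset.mul_sum, ← Finset.sum_neg_distrib]
      refine Finset.sum_congr rfl fun e _ => ?_
      rw [← mul_reversed hp0, Direction.vec_opp]
      push_cast [Pi.neg_apply]
      ring
    rw [Finset.sum_congr rfl fun x _ => h1 x, Finset.sum_sub_distrib,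
      sum_edgeReversal (fun x e => p x * r x e * (e.vec k : ℝ)), sub_self]
  unfold mean toC
  exact_mod_cast h

end

/-! ### Differential inequalities -/

/-- The function `(E - c) e^{κt}` is nonincreasing. Comparing times `0` and `T`, where `E` agrees,
forces `E 0 ≤ c`, and monotonicity carries the bound to all later times. -/
theorem le_of_periodic_of_deriv_le {E E' : ℝ → ℝ} {κ c T : ℝ} (hκ : 0 < κ) (hT : 0 < T)
    (hc : ContinuousOn E (Ici 0)) (hd : ∀ t, 0 < t → HasDerivAt E (E' t) t)
    (hle : ∀ t, 0 < t → E' t ≤ -κ * E t + κ * c) (hper : E T = E 0) (t : ℝ) (ht : 0 ≤ t) :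
    E t ≤ c := by
  have hanti : AntitoneOn (fun s => (E s - c) * Real.exp (κ * s)) (Ici 0) := by
    have hd' : ∀ s, 0 < s → HasDerivAt (fun s => (E s - c) * Real.exp (κ * s))
        (E' s * Real.exp (κ * s) + (E s - c) * (Real.exp (κ * s) * (κ * 1))) s := fun s hs =>
      ((hd s hs).sub_const c).mul (((hasDerivAt_id s).const_mul κ).exp)
    refine antitoneOn_of_deriv_nonpos (convex_Ici 0) ?_ ?_ ?_
    · exact (hc.sub continuousOn_const).mul (by fun_prop)
    · intro s hs
      rw [interior_Ici] at hs
      exact (hd' s hs).differentiableAt.differentiableWithinAt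
    · intro s hs
      rw [interior_Ici] at hs
      rw [(hd' s hs).deriv]
      have := hle s hs
      have h2 := Real.exp_pos (κ * s)
      nlinarith
  have h0 : E 0 - c ≤ 0 := by
    have h1 := hanti (mem_Ici.2 le_rfl) (mem_Ici.2 hT.le) hT.le
    simp only [hper, mul_zero, Real.exp_zero, mul_one] at h1
    have h2 : 1 < Real.exp (κ * T) := Real.one_lt_exp_iff.2 (mul_pos hκ hT)
    nlinarith
  have h1 := hanti (mem_Ici.2 le_rfl) (mem_Ici.2 ht) ht
  simp only [mul_zero, Real.exp_zero, mul_one] at h1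
  have h2 := Real.exp_pos (κ * t)
  by_contra h3
  have := mul_pos (sub_pos.2 (not_le.1 h3)) h2
  linarith

theorem le_exp_of_deriv_le {E E' : ℝ → ℝ} {κ : ℝ}
    (hd : ∀ t, HasDerivAt E (E' t) t)
    (hle : ∀ t, E' t ≤ -κ * E t) (t : ℝ) (ht : 0 ≤ t) :
    E t ≤ E 0 * Real.exp (-κ * t) := by
  have hd' : ∀ s, HasDerivAt (fun s => E s * Real.exp (κ * s))
      (E' s * Real.exp (κ * s) + E s * (Real.exp (κ * s) * (κ * 1))) s := fun s =>
    (hd s).mul (((hasDerivAt_id s).const_mul κ).exp)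
  have hanti : Antitone (fun s => E s * Real.exp (κ * s)) := by
    refine antitone_of_deriv_nonpos (fun s => (hd' s).differentiableAt) fun s => ?_
    rw [(hd' s).deriv]
    have := hle s
    have h2 := Real.exp_pos (κ * s)
    nlinarith
  have h1 := hanti ht
  have h1 : E t * Real.exp (κ * t) ≤ E 0 := by simpa using h1
  calc E t = (E t * Real.exp (κ * t)) * Real.exp (-κ * t) := by
        rw [mul_assoc, ← Real.exp_add]; simp
    _ ≤ _ := mul_le_mul_of_nonneg_right h1 (Real.exp_pos _).le

section

variable [NeZero N] {r : Rates d N} {p : Torus d N → ℝ}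

theorem hasDerivAt_energy {h : ℝ → Torus d N → ℂ} {h' : Torus d N → ℂ} {t : ℝ}
    (hd : ∀ x, HasDerivAt (fun s => h s x) (h' x) t) :
    HasDerivAt (fun s => energy p (h s))
      (∑ x, p x * (2 * (starRingEnd ℂ (h t x) * h' x).re)) t := by
  unfold energy
  refine HasDerivAt.fun_sum fun x _ => HasDerivAt.const_mul _ ?_
  have := (hd x).norm_sq
  rwa [Complex.inner, mul_comm (h' x)] at this

/-- Solutions of `h' = L* h + g` which take the same value at times `0` and `T` and have mean zero
are controlled by the forcing `g`. -/
theorem exists_periodic_bound (hr : ∀ x e, 0 < r x e) (hp0 : ∀ x, 0 < p x)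
    (hp : IsInvariant r p) :
    ∃ C : ℝ, 0 ≤ C ∧ ∀ (h g : ℝ → Torus d N → ℂ) (T K : ℝ), 0 < T → 0 ≤ K →
      (∀ x, ContinuousOn (fun t => h t x) (Ici 0)) →
      (∀ t, 0 < t → ∀ x, HasDerivAt (fun s => h s x) (adjGenerator r p (h t) x + g t x) t) →
      (∀ t, 0 < t → ‖g t‖ ≤ K) → (∀ t, 0 < t → mean p (h t) = 0) → h T = h 0 →
      ∀ t, 0 ≤ t → ‖h t‖ ≤ C * K := by
  obtain ⟨κ, hκ, hpoin⟩ := exists_poincare hr hp0 hp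
  obtain ⟨m, hm, -, hmE⟩ := exists_norm_sq_le_energy hp0
  -- From the energy bound `4K²/κ²` below together with `m ‖h‖² ≤ energy`.
  refine ⟨Real.sqrt (4 / κ ^ 2 / m), Real.sqrt_nonneg _, ?_⟩
  intro h g T K hT hK hc hd hg hmean hper t ht
  have hE : energy p (h t) ≤ 4 * K ^ 2 / κ ^ 2 := by
    -- Half of the Poincaré rate absorbs the forcing: `E' ≤ -κE + (κ/2)E + (2/κ)K²`, whose
    -- equilibrium level is `4K²/κ²`.
    refine le_of_periodic_of_deriv_le (E := fun t => energy p (h t)) (κ := κ / 2)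
      (by positivity) hT ?_ (fun s hs => hasDerivAt_energy (hd s hs)) ?_ (by simp [hper]) t ht
    · unfold energy
      refine continuousOn_finsetSum _ fun x _ => continuousOn_const.mul ((hc x).norm.pow 2)
    · intro s hs
      have h1 : ∀ x, p x * (2 * (starRingEnd ℂ (h s x) * (adjGenerator r p (h s) x + g s x)).re)
          = p x * (2 * (starRingEnd ℂ (h s x) * adjGenerator r p (h s) x).re)
            + p x * (2 * (starRingEnd ℂ (h s x) * g s x).re) := by
        intro x; rw [mul_add, Complex.add_re]; ring
      rw [Finset.sum_congr rfl fun x _ => h1 x, Finset.sum_add_distrib,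
        two_re_adjGenerator hp0 hp]
      have h2 : ∑ x, p x * (2 * (starRingEnd ℂ (h s x) * g s x).re) ≤
          ∑ x, p x * (κ / 2 * ‖h s x‖ ^ 2 + 2 / κ * K ^ 2) := by
        refine Finset.sum_le_sum fun x _ => mul_le_mul_of_nonneg_left ?_ (hp0 x).le
        have h3 : (starRingEnd ℂ (h s x) * g s x).re ≤ ‖h s x‖ * K := by
          refine (Complex.re_le_norm _).trans ?_
          rw [norm_mul, RCLike.norm_conj]
          exact mul_le_mul_of_nonneg_left ((norm_le_pi_norm _ x).trans (hg s hs)) (norm_nonneg _)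
        -- Young's inequality `2ab ≤ (κ/2)a² + (2/κ)b²`, as a completed square.
        have h4 : 0 ≤ 2 / κ * (κ / 2 * ‖h s x‖ - K) ^ 2 := by positivity
        have h5 : 2 / κ * (κ / 2 * ‖h s x‖ - K) ^ 2 =
            κ / 2 * ‖h s x‖ ^ 2 + 2 / κ * K ^ 2 - 2 * (‖h s x‖ * K) := by
          field_simp; ring
        linarith
      have h6 : ∑ x, p x * (κ / 2 * ‖h s x‖ ^ 2 + 2 / κ * K ^ 2) =
          κ / 2 * energy p (h s) + 2 / κ * K ^ 2 := by
        simp only [mul_add, Finset.sum_add_distrib, ← Finset.sum_mul, hp.sum_eq_one, one_mul]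
        rw [energy, Finset.mul_sum]
        congr 1
        exact Finset.sum_congr rfl fun x _ => by ring
      have h7 := hpoin _ (hmean s hs)
      have h8 : κ / 2 * (4 * K ^ 2 / κ ^ 2) = 2 / κ * K ^ 2 := by field_simp; ring
      rw [h8]
      linarith
  have h1 := (hmE (h t)).trans hE
  have h2 : ‖h t‖ ^ 2 ≤ (4 / κ ^ 2 / m) * K ^ 2 := by
    rw [div_mul_eq_mul_div, le_div_iff₀ hm]
    calc _ = m * ‖h t‖ ^ 2 := mul_comm _ _
      _ ≤ _ := h1
      _ = _ := by ring
  rw [← Real.sqrt_sq hK, ← Real.sqrt_mul (by positivity)]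
  exact Real.le_sqrt_of_sq_le h2

/-! ### The Laplace transform of the semigroup -/

section

variable {E : Type*} [NormedAddCommGroup E] [NormedSpace ℂ E] [CompleteSpace E]

theorem hasDerivAt_exp_neg_smul (B : E →L[ℂ] E) (f : E) (s : ℝ) :
    HasDerivAt (fun s : ℝ => NormedSpace.exp (-((s : ℂ) • B)) f)
      (-(B (NormedSpace.exp (-((s : ℂ) • B)) f))) s := by
  have h1 : HasDerivAt (fun s : ℝ => NormedSpace.exp (-((s : ℂ) • B)))
      ((-B) * NormedSpace.exp (-((s : ℂ) • B))) s := by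
    have h := (hasDerivAt_exp_smul_const' (𝕂 := ℂ) (-B) (s : ℂ)).scomp s
      (Complex.ofRealCLM.hasDerivAt (x := s))
    simp only [Complex.ofRealCLM_apply, Complex.ofReal_one, one_smul, smul_neg,
      Function.comp_def] at h
    exact h
  exact ((ContinuousLinearMap.apply ℂ E f).restrictScalars ℝ).hasFDerivAt.comp_hasDerivAt s h1

omit [CompleteSpace E] in
theorem exp_neg_zero_smul (B : E →L[ℂ] E) (f : E) :
    NormedSpace.exp (-(((0 : ℝ) : ℂ) • B)) f = f := by simp

omit [CompleteSpace E] in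
theorem apply_exp_neg_smul (B : E →L[ℂ] E) (f : E) (s : ℝ) :
    B (NormedSpace.exp (-((s : ℂ) • B)) f) = NormedSpace.exp (-((s : ℂ) • B)) (B f) := by
  have h1 : Commute B (NormedSpace.exp (-((s : ℂ) • B))) :=
    (((Commute.refl B).smul_right (s : ℂ)).neg_right).exp_right
  exact congrArg (fun A : E →L[ℂ] E => A f) h1.eq

end

/-- The orbit solves `y' = L* y - iω y`, and the rotation `-iω` does not affect moduli. Hence the
mean has constant modulus and stays zero, so the Poincaré inequality gives exponential decay of the
energy. -/
theorem exists_semigroup_bound (hr : ∀ x e, 0 < r x e) (hp0 : ∀ x, 0 < p x)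
    (hp : IsInvariant r p) (ω : ℝ) {f : Torus d N → ℂ} (hf : mean p f = 0) :
    ∃ κ C : ℝ, 0 < κ ∧ ∀ s : ℝ, 0 ≤ s →
      ‖NormedSpace.exp (-((s : ℂ) • (algebraMap ℂ ((Torus d N → ℂ) →L[ℂ] (Torus d N → ℂ))
        (Complex.I * (ω : ℂ)) - adjGenerator r p))) f‖ ≤ C * Real.exp (-κ * s) := by
  obtain ⟨κ, hκ, hpoin⟩ := exists_poincare hr hp0 hp
  obtain ⟨m, hm, -, hmE⟩ := exists_norm_sq_le_energy hp0
  set B := algebraMap ℂ ((Torus d N → ℂ) →L[ℂ] (Torus d N → ℂ))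
        (Complex.I * (ω : ℂ)) - adjGenerator r p with hB
  set y : ℝ → Torus d N → ℂ := fun s => NormedSpace.exp (-((s : ℂ) • B)) f with hy
  have hBy : ∀ g, -(B g) = adjGenerator r p g - (Complex.I * (ω : ℂ)) • g := by
    intro g; simp [hB, Algebra.algebraMap_eq_smul_one]
  have hd : ∀ s, HasDerivAt y (adjGenerator r p (y s) - (Complex.I * (ω : ℂ)) • y s) s := by
    intro s
    have := hasDerivAt_exp_neg_smul B f s
    rwa [hBy] at this
  have hdx : ∀ s x, HasDerivAt (fun s => y s x)
      (adjGenerator r p (y s) x - (Complex.I * (ω : ℂ)) * y s x) s := by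
    intro s x
    simpa using (hasDerivAt_pi.1 (hd s)) x
  have hy0 : y 0 = f := exp_neg_zero_smul B f
  have hre : ∀ z : ℂ, (starRingEnd ℂ z * (Complex.I * (ω : ℂ) * z)).re = 0 := by
    intro z
    simp only [Complex.mul_re, Complex.mul_im, Complex.conj_re,
        Complex.conj_im, Complex.I_re, Complex.I_im, Complex.ofReal_re, Complex.ofReal_im]
    ring
  have hmean : ∀ s, mean p (y s) = 0 := by
    have hdm : ∀ s, HasDerivAt (fun s => mean p (y s))
        (-(Complex.I * (ω : ℂ)) * mean p (y s)) s := by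
      intro s
      have h1 : HasDerivAt (fun s => mean p (y s))
          (mean p (adjGenerator r p (y s) - (Complex.I * (ω : ℂ)) • y s)) s := by
        unfold mean
        refine HasDerivAt.fun_sum fun x _ => HasDerivAt.const_mul _ ?_
        simpa using hdx s x
      rw [mean_sub, mean_adjGenerator hp0 hp, mean_smul, zero_sub, ← neg_mul] at h1
      exact h1
    have hn : ∀ s, HasDerivAt (fun s => ‖mean p (y s)‖ ^ 2) 0 s := by
      intro s
      convert (hdm s).norm_sq using 1
      have := hre (mean p (y s))
      simp only [Complex.inner]
      rw [mul_comm (_ * _), neg_mul, mul_neg, Complex.neg_re, this]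
      simp
    intro s
    have h1 := is_const_of_deriv_eq_zero (fun s => (hn s).differentiableAt)
      (fun s => (hn s).deriv) s 0
    simpa [hy0, hf] using h1
  have hE : ∀ s, 0 ≤ s → energy p (y s) ≤ energy p (y 0) * Real.exp (-κ * s) := by
    refine le_exp_of_deriv_le (E := fun s => energy p (y s)) (fun s => hasDerivAt_energy (hdx s))
      fun s => ?_
    have h1 : ∀ x, p x * (2 * (starRingEnd ℂ (y s x) *
        (adjGenerator r p (y s) x - Complex.I * (ω : ℂ) * y s x)).re) =
        p x * (2 * (starRingEnd ℂ (y s x) * adjGenerator r p (y s) x).re) := by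
      intro x; rw [mul_sub, Complex.sub_re, hre, sub_zero]
    rw [Finset.sum_congr rfl fun x _ => h1 x, two_re_adjGenerator hp0 hp]
    have := hpoin _ (hmean s)
    linarith
  -- The energy is a squared norm, so taking the square root halves the rate.
  refine ⟨κ / 2, Real.sqrt (energy p f / m), by positivity, fun s hs => ?_⟩
  have h1 := (hmE (y s)).trans (hE s hs)
  rw [hy0] at h1
  refine le_of_sq_le_sq ?_ (by positivity)
  rw [mul_pow, Real.sq_sqrt (div_nonneg (energy_nonneg hp0 f) hm.le), ← Real.exp_nat_mul,
    div_mul_eq_mul_div, le_div_iff₀ hm, mul_comm]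
  convert h1 using 3
  push_cast; ring

theorem continuous_scal (p : Torus d N → ℝ) (f : Torus d N → ℂ) : Continuous (scal p f) := by
  unfold scal; fun_prop

theorem norm_scal_le (p : Torus d N → ℝ) (f h : Torus d N → ℂ) :
    ‖scal p f h‖ ≤ (∑ x, ‖p x‖ * ‖f x‖) * ‖h‖ := by
  unfold scal
  refine (norm_sum_le _ _).trans ?_
  rw [Finset.sum_mul]
  refine Finset.sum_le_sum fun x _ => ?_
  rw [norm_mul, norm_mul, RCLike.norm_conj, Complex.norm_real, ← mul_assoc]
  exact mul_le_mul_of_nonneg_left (norm_le_pi_norm h x) (by positivity)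

/-- With `B = iω - L*` and `w = B⁻¹ h`, the derivative of `⟨f, e^{-Bs} w⟩` is `-⟨f, e^{-Bs} h⟩`.
Integration over `(0, ∞)` leaves only the boundary term at `0`, because `w` has mean zero as well
and its orbit decays. -/
theorem laplace_resolvent (hr : ∀ x e, 0 < r x e) (hp0 : ∀ x, 0 < p x)
    (hp : IsInvariant r p) {ω : ℝ} (hω : ω ≠ 0) (f : Torus d N → ℂ) {h : Torus d N → ℂ}
    (hh : mean p h = 0) :
    IntegrableOn (laplaceIntegrand p (adjGenerator r p) ω f h) (Ioi 0) ∧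
      scal p f (resolvent (adjGenerator r p) (Complex.I * (ω : ℂ)) h) =
        ∫ s in Ioi (0 : ℝ), laplaceIntegrand p (adjGenerator r p) ω f h s := by
  have hz := mem_resolventSet_adjGenerator hr hp0 hp hω
  have hz0 : Complex.I * (ω : ℂ) ≠ 0 := by simp [hω]
  set w := resolvent (adjGenerator r p) (Complex.I * (ω : ℂ)) h with hw
  have hwm : mean p w = 0 := mean_resolvent hp0 hp hz0 hz hh
  set B := algebraMap ℂ ((Torus d N → ℂ) →L[ℂ] (Torus d N → ℂ))
        (Complex.I * (ω : ℂ)) - adjGenerator r p with hB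
  have hBw : B w = h := by
    have := resolvent_equation hz h
    simpa [hB, Algebra.algebraMap_eq_smul_one] using this
  have hdec : ∀ g : Torus d N → ℂ, mean p g = 0 → ∃ κ C : ℝ, 0 < κ ∧ ∀ s : ℝ, 0 ≤ s →
      ‖scal p f (NormedSpace.exp (-((s : ℂ) • B)) g)‖ ≤ C * Real.exp (-κ * s) := by
    intro g hg
    obtain ⟨κ, C, hκ, hC⟩ := exists_semigroup_bound hr hp0 hp ω hg
    refine ⟨κ, (∑ x, ‖p x‖ * ‖f x‖) * C, hκ, fun s hs => (norm_scal_le _ _ _).trans ?_⟩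
    rw [mul_assoc]
    exact mul_le_mul_of_nonneg_left (hC s hs) (by positivity)
  have hcont : ∀ g : Torus d N → ℂ,
      Continuous fun s : ℝ => scal p f (NormedSpace.exp (-((s : ℂ) • B)) g) := fun g =>
    (continuous_scal p f).comp
      (continuous_iff_continuousAt.2 fun s => (hasDerivAt_exp_neg_smul B g s).continuousAt)
  have hint : IntegrableOn (laplaceIntegrand p (adjGenerator r p) ω f h) (Ioi 0) := by
    obtain ⟨κ, C, hκ, hC⟩ := hdec h hh
    refine Integrable.mono' ((exp_neg_integrableOn_Ioi 0 hκ).const_mul C)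
      (hcont h).aestronglyMeasurable.restrict ?_
    filter_upwards [ae_restrict_mem measurableSet_Ioi] with s hs
    exact hC s (le_of_lt hs)
  refine ⟨hint, ?_⟩
  have hderiv : ∀ s ∈ Ici (0 : ℝ),
      HasDerivAt (fun s : ℝ => scal p f (NormedSpace.exp (-((s : ℂ) • B)) w))
        (-laplaceIntegrand p (adjGenerator r p) ω f h s) s := by
    intro s _
    have hcomm : B (NormedSpace.exp (-((s : ℂ) • B)) w) = NormedSpace.exp (-((s : ℂ) • B)) h := by
      rw [apply_exp_neg_smul, hBw]
    have h1 := hasDerivAt_pi.1 (hasDerivAt_exp_neg_smul B w s)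
    rw [hcomm] at h1
    have h2 : HasDerivAt (fun s : ℝ => scal p f (NormedSpace.exp (-((s : ℂ) • B)) w))
        (scal p f (-(NormedSpace.exp (-((s : ℂ) • B)) h))) s := by
      unfold scal
      exact HasDerivAt.fun_sum fun x _ => ((h1 x).const_mul _).const_mul _
    convert h2 using 1
    simp [laplaceIntegrand, scal, hB]
  have hlim : Tendsto (fun s : ℝ => scal p f (NormedSpace.exp (-((s : ℂ) • B)) w)) atTop (𝓝 0) := by
    obtain ⟨κ, C, hκ, hC⟩ := hdec w hwm
    have h1 : Tendsto (fun s : ℝ => C * Real.exp (-κ * s)) atTop (𝓝 (C * 0)) := by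
      exact Tendsto.const_mul C (Real.tendsto_exp_atBot.comp
        (tendsto_id.const_mul_atTop_of_neg (neg_lt_zero.2 hκ)))
    rw [mul_zero] at h1
    refine squeeze_zero_norm' ?_ h1
    filter_upwards [eventually_ge_atTop 0] with s hs using hC s hs
  have := integral_Ioi_of_hasDerivAt_of_tendsto' hderiv hint.neg hlim
  rw [integral_neg] at this
  rw [exp_neg_zero_smul, zero_sub, neg_inj] at this
  exact this.symm

end

/-! ### The law of the lifted walk -/

/-- Time is rounded up to the next point `τ n t > t` of a grid of mesh `1/(n+1)`. The rounded
process depends on time through an integer, hence is jointly measurable, and it converges by right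
continuity. -/
theorem measurable_uncurry_of_rightContinuous {Ω : Type*} [MeasurableSpace Ω]
    {Y : ℝ≥0 → Ω → Fin d → ℤ} (hm : ∀ t, Measurable (Y t))
    (hc : ∀ a t, ContinuousWithinAt (fun s => Y s a) (Ici t) t) :
    Measurable fun q : ℝ≥0 × Ω => Y q.1 q.2 := by
  set τ : ℕ → ℝ≥0 → ℝ≥0 := fun n t => ((⌊((n : ℝ≥0) + 1) * t⌋₊ : ℝ≥0) + 1) / ((n : ℝ≥0) + 1)
    with hτ
  have hn0 : ∀ n : ℕ, (0 : ℝ≥0) < (n : ℝ≥0) + 1 := fun n => by positivity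
  have hge : ∀ n t, t ≤ τ n t := by
    intro n t
    rw [hτ, le_div_iff₀ (hn0 n), mul_comm]
    exact (Nat.lt_floor_add_one _).le
  have hle : ∀ n t, τ n t ≤ t + 1 / ((n : ℝ≥0) + 1) := by
    intro n t
    have h1 : t + 1 / ((n : ℝ≥0) + 1) = (((n : ℝ≥0) + 1) * t + 1) / ((n : ℝ≥0) + 1) := by
      have := (hn0 n).ne'
      field_simp
    rw [h1]
    simp only [hτ]
    gcongr
    exact Nat.floor_le (zero_le)
  have hlim : ∀ t, Tendsto (fun n => τ n t) atTop (𝓝[≥] t) := by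
    intro t
    refine tendsto_nhdsWithin_iff.2 ⟨?_, Eventually.of_forall fun n => hge n t⟩
    have h1 : Tendsto (fun n : ℕ => t + 1 / ((n : ℝ≥0) + 1)) atTop (𝓝 (t + 0)) :=
      tendsto_const_nhds.add (tendsto_one_div_add_atTop_nhds_zero_nat (𝕜 := ℝ≥0))
    rw [add_zero] at h1
    exact tendsto_of_tendsto_of_tendsto_of_le_of_le tendsto_const_nhds h1
      (fun n => hge n t) (fun n => hle n t)
  refine measurable_of_tendsto_metrizable (f := fun n (q : ℝ≥0 × Ω) => Y (τ n q.1) q.2) ?_ ?_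
  · intro n
    have h1 : Measurable fun q : ℕ × Ω => Y (((q.1 : ℝ≥0) + 1) / ((n : ℝ≥0) + 1)) q.2 :=
      measurable_from_prod_countable_right fun k =>
        hm (((k : ℝ≥0) + 1) / ((n : ℝ≥0) + 1))
    have h2 : Measurable fun q : ℝ≥0 × Ω => (⌊((n : ℝ≥0) + 1) * q.1⌋₊, q.2) :=
      (Nat.measurable_floor.comp (measurable_fst.const_mul _)).prodMk measurable_snd
    have h3 := h1.comp h2
    simp only [Function.comp_def] at h3
    simpa only [hτ] using h3
  · rw [tendsto_pi_nhds]
    intro q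
    exact (hc q.2 q.1).tendsto.comp (hlim q.1)

/-! ### Perturbed rates: continuity and uniform bounds. -/

theorem continuous_perturbed (r : Rates d N) (ω : ℝ) (v : Fin d → ℝ) (l : ℝ) (x : Torus d N)
    (e : Direction d) : Continuous fun s => perturbed r ω v l s x e := by
  unfold perturbed; fun_prop

section

variable [NeZero N]

/-- A bound on the total jump rates of the perturbed walk. -/
noncomputable def rateBound (r : Rates d N) (v : Fin d → ℝ) (l : ℝ) : ℝ :=
  ∑ x, ∑ e : Direction d, Real.exp |l * e.dot v| * |r x e|

theorem sum_abs_perturbed_le (r : Rates d N) (ω : ℝ) (v : Fin d → ℝ) (l s : ℝ) (x : Torus d N) :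
    ∑ e, |perturbed r ω v l s x e| ≤ rateBound r v l := by
  refine le_trans (Finset.sum_le_sum fun e _ => ?_)
    (Finset.single_le_sum (f := fun x => ∑ e : Direction d, Real.exp |l * e.dot v| * |r x e|)
      (fun _ _ => Finset.sum_nonneg fun _ _ => by positivity) (Finset.mem_univ x))
  rw [perturbed, abs_mul, Real.abs_exp]
  refine mul_le_mul_of_nonneg_right (Real.exp_le_exp.2 ((le_abs_self _).trans ?_)) (abs_nonneg _)
  rw [mul_right_comm, abs_mul]
  exact mul_le_of_le_one_right (abs_nonneg _) (Real.abs_cos_le_one _)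

/-- The bound involves the increments of `f` and not its size, so it is uniform over truncations of
a coordinate. -/
theorem abs_liftedGenerator_le (r : Rates d N) (ω : ℝ) (v : Fin d → ℝ) (l s : ℝ)
    {f : (Fin d → ℤ) → ℝ} {c : ℝ} (hf : ∀ y (e : Direction d), |f (y + e.vec) - f y| ≤ c)
    (hc : 0 ≤ c) (y : Fin d → ℤ) :
    |liftedGenerator r ω v l s f y| ≤ rateBound r v l * c := by
  refine le_trans ?_ (mul_le_mul_of_nonneg_right (sum_abs_perturbed_le r ω v l s (proj N y)) hc)
  rw [Finset.sum_mul]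
  refine (Finset.abs_sum_le_sum_abs _ _).trans (Finset.sum_le_sum fun e _ => ?_)
  rw [abs_mul]
  exact mul_le_mul_of_nonneg_left (hf y e) (abs_nonneg _)

section

variable {r : Rates d N} {ω : ℝ} {v : Fin d → ℝ} {l : ℝ} {Ω : Type*} [mΩ : MeasurableSpace Ω]
  {P : Measure Ω} {Y : ℝ≥0 → Ω → Fin d → ℤ}

omit [NeZero N] in
theorem IsLiftedWalk.measurable (h : IsLiftedWalk r ω v l P Y) (t : ℝ≥0) : Measurable (Y t) := by
  obtain ⟨ℱ, hℱ, -⟩ := h.martingale_problem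
  exact (hℱ t).mono (ℱ.le t) le_rfl

omit [NeZero N] in
theorem IsLiftedWalk.measurable_uncurry (h : IsLiftedWalk r ω v l P Y) :
    Measurable fun q : ℝ × Ω => Y q.1.toNNReal q.2 :=
  (measurable_uncurry_of_rightContinuous h.measurable h.right_continuous).comp
    ((measurable_real_toNNReal.comp measurable_fst).prodMk measurable_snd)

omit [NeZero N] in
theorem IsLiftedWalk.measurable_liftedGenerator (h : IsLiftedWalk r ω v l P Y)
    (f : (Fin d → ℤ) → ℝ) :
    Measurable fun q : ℝ × Ω => liftedGenerator r ω v l q.1 f (Y q.1.toNNReal q.2) := by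
  have hY := h.measurable_uncurry
  unfold liftedGenerator perturbed
  refine Finset.measurable_sum _ fun e _ => ?_
  have h1 : Measurable fun q : ℝ × Ω => r (proj N (Y q.1.toNNReal q.2)) e :=
    (Measurable.of_discrete (f := fun y => r (proj N y) e)).comp hY
  have h2 : Measurable fun q : ℝ × Ω =>
      f (Y q.1.toNNReal q.2 + e.vec) - f (Y q.1.toNNReal q.2) :=
    (Measurable.of_discrete (f := fun y => f (y + e.vec) - f y)).comp hY
  have h3 : Measurable fun q : ℝ × Ω => Real.exp (l * Real.cos (ω * q.1) * e.dot v) := by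
    fun_prop
  exact (h3.mul h1).mul h2

omit [NeZero N] in
theorem IsLiftedWalk.measurable_integral_liftedGenerator [IsProbabilityMeasure P]
    (h : IsLiftedWalk r ω v l P Y) (f : (Fin d → ℤ) → ℝ) :
    StronglyMeasurable fun s : ℝ => ∫ a, liftedGenerator r ω v l s f (Y s.toNNReal a) ∂P :=
  StronglyMeasurable.integral_prod_right'
    (f := fun q : ℝ × Ω => liftedGenerator r ω v l q.1 f (Y q.1.toNNReal q.2))
    (h.measurable_liftedGenerator f).stronglyMeasurable

/-- Dynkin's formula. -/
theorem IsLiftedWalk.expectation_eq [IsProbabilityMeasure P] (h : IsLiftedWalk r ω v l P Y)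
    {f : (Fin d → ℤ) → ℝ} (hf : ∃ C, ∀ y, |f y| ≤ C) {t : ℝ} (ht : 0 ≤ t) :
    ∫ a, f (Y t.toNNReal a) ∂P = ∫ a, f (Y 0 a) ∂P +
      ∫ s in (0 : ℝ)..t, ∫ a, liftedGenerator r ω v l s f (Y s.toNNReal a) ∂P := by
  obtain ⟨ℱ, hℱ, hmart⟩ := h.martingale_problem
  have hM := hmart f hf
  obtain ⟨C, hC⟩ := hf
  have hC0 : 0 ≤ C := (abs_nonneg _).trans (hC 0)
  have h1 := hM.setIntegral_eq (zero_le (a := t.toNNReal)) MeasurableSet.univ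
  simp only [setIntegral_univ, NNReal.coe_zero, intervalIntegral.integral_same, sub_zero,
    Real.coe_toNNReal t ht] at h1
  have hint1 : Integrable (fun a => f (Y t.toNNReal a)) P := by
    refine Integrable.of_bound (C := C) ?_ (Eventually.of_forall fun a => hC _)
    exact ((Measurable.of_discrete (f := f)).comp (h.measurable _)).aestronglyMeasurable
  have hint2 := hint1.sub (hM.integrable t.toNNReal)
  simp only [Real.coe_toNNReal t ht] at hint2
  -- The time integral is the difference of the bounded variable `f(Y_t)` and the martingale.
  have hint3 : Integrable
      (fun a => ∫ s in (0 : ℝ)..t, liftedGenerator r ω v l s f (Y s.toNNReal a)) P := by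
    refine hint2.congr (Eventually.of_forall fun a => ?_)
    simp
  rw [integral_sub hint1 hint3] at h1
  rw [h1, intervalIntegral_integral_swap, sub_add_cancel]
  have hb : ∀ q : ℝ × Ω, ‖liftedGenerator r ω v l q.1 f (Y q.1.toNNReal q.2)‖ ≤
      rateBound r v l * (C + C) := fun q =>
    abs_liftedGenerator_le r ω v l q.1
      (fun y e => (abs_sub _ _).trans (add_le_add (hC _) (hC _))) (by positivity) _
  rw [uIoc_of_le ht]
  exact Integrable.of_bound (C := rateBound r v l * (C + C))
    (h.measurable_liftedGenerator f).aestronglyMeasurable (Eventually.of_forall hb)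

/-- The law at time `t` of the walk on the torus. -/
noncomputable def law (N : ℕ) (P : Measure Ω) (Y : ℝ≥0 → Ω → Fin d → ℤ) (t : ℝ)
    (x : Torus d N) : ℝ :=
  P.real {a | proj N (Y t.toNNReal a) = x}

theorem integral_comp_proj [IsProbabilityMeasure P] (hY : ∀ t, Measurable (Y t)) (t : ℝ)
    (g : Torus d N → ℝ) :
    ∫ a, g (proj N (Y t.toNNReal a)) ∂P = ∑ x, law N P Y t x * g x := by
  let _ : MeasurableSpace (Torus d N) := ⊤
  have : MeasurableSingletonClass (Torus d N) := ⟨fun _ => trivial⟩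
  have hm : Measurable fun a => proj N (Y t.toNNReal a) :=
    (Measurable.of_discrete (f := proj N)).comp (hY _)
  have h1 : ∫ a, g (proj N (Y t.toNNReal a)) ∂P =
      ∫ x, g x ∂(P.map fun a => proj N (Y t.toNNReal a)) :=
    (integral_map hm.aemeasurable (measurable_from_top (f := g)).aestronglyMeasurable).symm
  have := Measure.isProbabilityMeasure_map (μ := P) hm.aemeasurable
  rw [h1, integral_fintype (Integrable.of_finite)]
  refine Finset.sum_congr rfl fun x _ => ?_
  rw [map_measureReal_apply hm (measurableSet_singleton x), smul_eq_mul]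
  rfl

omit [NeZero N] in
theorem law_nonneg (t : ℝ) (x : Torus d N) : 0 ≤ law N P Y t x := measureReal_nonneg

omit [NeZero N] in
theorem law_le_one [IsProbabilityMeasure P] (t : ℝ) (x : Torus d N) : law N P Y t x ≤ 1 :=
  measureReal_le_one

theorem sum_law [IsProbabilityMeasure P] (hY : ∀ t, Measurable (Y t)) (t : ℝ) :
    ∑ x, law N P Y t x = 1 := by
  simpa using (integral_comp_proj (P := P) (N := N) hY t fun _ => 1).symm

/-- The forward equation in integrated form. -/
theorem IsLiftedWalk.law_eq [IsProbabilityMeasure P] (h : IsLiftedWalk r ω v l P Y)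
    {t : ℝ} (ht : 0 ≤ t) (x : Torus d N) :
    law N P Y t x = law N P Y 0 x + ∫ s in (0 : ℝ)..t,
      (∑ e : Direction d, law N P Y s (nbr x e) * perturbed r ω v l s (nbr x e) e.opp
        - law N P Y s x * ∑ e, perturbed r ω v l s x e) := by
  classical
  -- Dynkin's formula is applied to the indicator of `x`, read modulo `N`.
  set g : Torus d N → ℝ := fun y => if y = x then 1 else 0 with hg
  have h1 := h.expectation_eq (f := fun y => g (proj N y))
    ⟨1, fun y => by simp only [hg]; split_ifs <;> simp⟩ ht
  have h2 : ∀ s, ∑ y, law N P Y s y * g y = law N P Y s x := by intro s; simp [hg]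
  have h0 := integral_comp_proj (P := P) h.measurable 0 g
  rw [Real.toNNReal_zero] at h0
  rw [integral_comp_proj h.measurable t g, h0, h2, h2] at h1
  rw [h1]
  congr 1
  refine intervalIntegral.integral_congr fun s _ => ?_
  have h3 : ∀ y, liftedGenerator r ω v l s (fun y => g (proj N y)) y =
      (fun z => ∑ e : Direction d, perturbed r ω v l s z e * (g (nbr z e) - g z)) (proj N y) := by
    intro y
    simp only [liftedGenerator, proj_add_vec]
  simp only [h3]
  rw [integral_comp_proj h.measurable s
    (fun z => ∑ e : Direction d, perturbed r ω v l s z e * (g (nbr z e) - g z))]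
  have h4 : ∀ z, law N P Y s z * ∑ e : Direction d, perturbed r ω v l s z e * (g (nbr z e) - g z) =
      ∑ e : Direction d, law N P Y s z * perturbed r ω v l s z e * g (nbr z e)
        - (law N P Y s z * ∑ e, perturbed r ω v l s z e) * g z := by
    intro z
    rw [Finset.mul_sum, Finset.mul_sum, Finset.sum_mul, ← Finset.sum_sub_distrib]
    exact Finset.sum_congr rfl fun e _ => by ring
  -- Edge reversal moves the indicator from the target of the jump to its base point, which selects
  -- the edges entering `x`.
  rw [Finset.sum_congr rfl fun z _ => h4 z, Finset.sum_sub_distrib,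
    ← sum_edgeReversal fun z e => law N P Y s z * perturbed r ω v l s z e * g (nbr z e)]
  simp only [nbr_nbr_opp, ← Finset.sum_mul]
  simp [hg]

theorem measurable_law (h : IsLiftedWalk r ω v l P Y) [IsProbabilityMeasure P] (x : Torus d N) :
    Measurable fun s => law N P Y s x := by
  classical
  have h1 : ∀ s, law N P Y s x =
      ∫ a, (fun y : Fin d → ℤ => if proj N y = x then (1 : ℝ) else 0) (Y s.toNNReal a) ∂P := by
    intro s
    rw [integral_comp_proj h.measurable s (fun z => if z = x then (1 : ℝ) else 0)]
    simp
  simp only [h1]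
  exact (StronglyMeasurable.integral_prod_right'
    (f := fun q : ℝ × Ω =>
      (fun y : Fin d → ℤ => if proj N y = x then (1 : ℝ) else 0) (Y q.1.toNNReal q.2))
    ((Measurable.of_discrete
      (f := fun y : Fin d → ℤ => if proj N y = x then (1 : ℝ) else 0)).comp h.measurable_uncurry).stronglyMeasurable).measurable

omit [NeZero N] in
theorem abs_law_le_one [IsProbabilityMeasure P] (t : ℝ) (x : Torus d N) : |law N P Y t x| ≤ 1 := by
  rw [abs_of_nonneg (law_nonneg t x)]; exact law_le_one t x

/-- Bootstrap: the law is bounded and measurable, so the integrated forward equation makes it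
continuous; its integrand is then continuous and the equation can be differentiated. -/
theorem continuous_law [IsProbabilityMeasure P] (h : IsLiftedWalk r ω v l P Y) (x : Torus d N) :
    Continuous fun t => law N P Y t x := by
  -- At negative times `toNNReal` returns `0`, so the law is constant there.
  have h1 : ∀ t, law N P Y t x = law N P Y (max t 0) x := by
    intro t
    unfold law
    congr 3
    simp [Real.toNNReal]
  have hli : ∀ (y : Torus d N) (c : ℝ → ℝ), Continuous c → ∀ a b : ℝ,
      IntervalIntegrable (fun s => law N P Y s y * c s) volume a b := by
    intro y c hc a b
    refine IntervalIntegrable.mono_fun' (hc.norm.intervalIntegrable a b)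
      ((measurable_law h y).mul hc.measurable).aestronglyMeasurable
      (Eventually.of_forall fun s => ?_)
    change ‖law N P Y s y * c s‖ ≤ ‖c s‖
    rw [norm_mul]
    exact mul_le_of_le_one_left (norm_nonneg _) (abs_law_le_one s y)
  have h2 : Continuous fun t => law N P Y 0 x + ∫ s in (0 : ℝ)..t,
      (∑ e : Direction d, law N P Y s (nbr x e) * perturbed r ω v l s (nbr x e) e.opp
        - law N P Y s x * ∑ e, perturbed r ω v l s x e) := by
    refine continuous_const.add (intervalIntegral.continuous_primitive (fun a b => ?_) 0)
    refine IntervalIntegrable.sub ?_ (hli _ _ ?_ a b)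
    · have := IntervalIntegrable.sum (μ := volume) (a := a) (b := b) Finset.univ
        (f := fun (e : Direction d) s =>
          law N P Y s (nbr x e) * perturbed r ω v l s (nbr x e) e.opp)
        (fun e _ => hli _ _ (continuous_perturbed r ω v l _ _) a b)
      simpa [Finset.sum_fn] using this
    · exact continuous_finsetSum _ fun e _ => continuous_perturbed r ω v l _ _
  have h3 : (fun t => law N P Y t x) = (fun t => law N P Y 0 x + ∫ s in (0 : ℝ)..t,
      (∑ e : Direction d, law N P Y s (nbr x e) * perturbed r ω v l s (nbr x e) e.opp
        - law N P Y s x * ∑ e, perturbed r ω v l s x e)) ∘ fun t => max t 0 := by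
    funext t
    rw [h1, h.law_eq (le_max_right t 0)]
    rfl
  rw [h3]
  exact h2.comp (by fun_prop)

/-- The forward equation. -/
theorem IsLiftedWalk.hasDerivAt_law [IsProbabilityMeasure P] (h : IsLiftedWalk r ω v l P Y)
    {t : ℝ} (ht : 0 < t) (x : Torus d N) :
    HasDerivAt (fun s => law N P Y s x)
      (∑ e : Direction d, law N P Y t (nbr x e) * perturbed r ω v l t (nbr x e) e.opp
        - law N P Y t x * ∑ e, perturbed r ω v l t x e) t := by
  have hcont : Continuous fun s =>
      (∑ e : Direction d, law N P Y s (nbr x e) * perturbed r ω v l s (nbr x e) e.opp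
        - law N P Y s x * ∑ e, perturbed r ω v l s x e) :=
    (continuous_finsetSum _ fun e _ =>
      (continuous_law h _).mul (continuous_perturbed r ω v l _ _)).sub
      ((continuous_law h _).mul (continuous_finsetSum _ fun e _ => continuous_perturbed r ω v l _ _))
  refine ((hcont.integral_hasStrictDerivAt 0 t).hasDerivAt.const_add
    (law N P Y 0 x)).congr_of_eventuallyEq ?_
  filter_upwards [lt_mem_nhds ht] with s hs using h.law_eq hs.le x

/-! ### The mean velocity -/

theorem abs_vec_le_one (e : Direction d) (j : Fin d) : |((e.vec j : ℤ) : ℝ)| ≤ 1 := by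
  unfold Direction.vec
  by_cases hj : j = e.1
  · subst hj
    rcases Int.units_eq_one_or e.2 with h | h <;> simp [h]
  · simp [Pi.single_eq_of_ne hj]

/-- The truncations `min |y_j| n` are bounded and have increments at most `1`, so Dynkin's formula
bounds their expectations by `E|Y_0| + t · rateBound`, uniformly in `n`. Fatou's lemma concludes. -/
theorem IsLiftedWalk.integrable [IsProbabilityMeasure P] (h : IsLiftedWalk r ω v l P Y)
    {j : Fin d} (h0 : Integrable (fun a => (Y 0 a j : ℝ)) P) {t : ℝ} (ht : 0 ≤ t) :
    Integrable (fun a => (Y t.toNNReal a j : ℝ)) P := by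
  have hmeas : Measurable fun a => (Y t.toNNReal a j : ℝ) :=
    (Measurable.of_discrete (f := fun y : Fin d → ℤ => (y j : ℝ))).comp (h.measurable _)
  set f : ℕ → (Fin d → ℤ) → ℝ := fun n y => min |(y j : ℝ)| n with hf
  have hf0 : ∀ n y, 0 ≤ f n y := fun n y => le_min (abs_nonneg _) n.cast_nonneg
  have hfm : ∀ n s, Measurable fun a => f n (Y s a) := fun n s =>
    (Measurable.of_discrete (f := f n)).comp (h.measurable s)
  have hfi : ∀ n s, Integrable (fun a => f n (Y s a)) P := fun n s =>
    Integrable.of_bound (C := n) (hfm n s).aestronglyMeasurable (Eventually.of_forall fun a => by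
      rw [Real.norm_eq_abs, abs_of_nonneg (hf0 n _)]; exact min_le_right _ _)
  set K := ∫ a, |(Y 0 a j : ℝ)| ∂P + rateBound r v l * 1 * t with hK
  have hbound : ∀ n, ∫ a, f n (Y t.toNNReal a) ∂P ≤ K := by
    intro n
    rw [h.expectation_eq (f := f n)
      ⟨n, fun y => by rw [abs_of_nonneg (hf0 n y)]; exact min_le_right _ _⟩ ht, hK]
    refine add_le_add (integral_mono (hfi n 0) h0.abs fun a => min_le_left _ _) ?_
    have h1 := intervalIntegral.norm_integral_le_of_norm_le_const (a := 0) (b := t)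
      (C := rateBound r v l * 1)
      (f := fun s => ∫ a, liftedGenerator r ω v l s (f n) (Y s.toNNReal a) ∂P) (fun s _ => by
        have h2 := norm_integral_le_of_norm_le_const (μ := P)
          (f := fun a => liftedGenerator r ω v l s (f n) (Y s.toNNReal a))
          (C := rateBound r v l * 1) (Eventually.of_forall fun a =>
            abs_liftedGenerator_le r ω v l s (fun y e => by
              refine (abs_min_sub_min_le_max _ _ _ _).trans ?_
              simp only [sub_self, abs_zero]
              refine max_le ((abs_abs_sub_abs_le_abs_sub _ _).trans ?_) zero_le_one
              simpa using abs_vec_le_one e j) zero_le_one _)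
        simpa using h2)
    rw [sub_zero, abs_of_nonneg ht] at h1
    exact (le_abs_self _).trans h1
  refine ⟨hmeas.aestronglyMeasurable, ?_⟩
  have hfatou : ∫⁻ a, ENNReal.ofReal |(Y t.toNNReal a j : ℝ)| ∂P ≤
      liminf (fun n => ∫⁻ a, ENNReal.ofReal (f n (Y t.toNNReal a)) ∂P) atTop := by
    refine le_trans (lintegral_mono fun a => ?_)
      (lintegral_liminf_le fun n => (hfm n _).ennreal_ofReal)
    refine le_of_eq (Tendsto.liminf_eq ?_).symm
    refine tendsto_const_nhds.congr' ?_
    filter_upwards [eventually_ge_atTop ⌈|(Y t.toNNReal a j : ℝ)|⌉₊] with n hn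
    simp only [hf, min_eq_left (Nat.ceil_le.1 hn)]
  have hle : ∫⁻ a, ENNReal.ofReal |(Y t.toNNReal a j : ℝ)| ∂P ≤ ENNReal.ofReal K := by
    refine hfatou.trans ?_
    have h2 : ∀ n, ∫⁻ a, ENNReal.ofReal (f n (Y t.toNNReal a)) ∂P ≤ ENNReal.ofReal K := by
      intro n
      rw [← ofReal_integral_eq_lintegral_ofReal (hfi n _) (Eventually.of_forall fun a => hf0 n _)]
      exact ENNReal.ofReal_le_ofReal (hbound n)
    refine (liminf_le_liminf (Eventually.of_forall h2)).trans ?_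
    simp
  rw [hasFiniteIntegral_iff_norm]
  exact hle.trans_lt ENNReal.ofReal_lt_top

/-- The mean drift at time `t`. -/
noncomputable def drift (N : ℕ) [NeZero N] (r : Rates d N) (ω : ℝ) (v : Fin d → ℝ) (l : ℝ)
    (P : Measure Ω) (Y : ℝ≥0 → Ω → Fin d → ℤ) (t : ℝ) (j : Fin d) : ℝ :=
  ∑ x, law N P Y t x * ∑ e, perturbed r ω v l t x e * (e.vec j : ℝ)

theorem continuous_drift [IsProbabilityMeasure P] (h : IsLiftedWalk r ω v l P Y) (j : Fin d) :
    Continuous fun t => drift N r ω v l P Y t j :=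
  continuous_finsetSum _ fun x _ => (continuous_law h x).mul
    (continuous_finsetSum _ fun e _ => (continuous_perturbed r ω v l x e).mul continuous_const)

/-- Dynkin's formula for the coordinate clamped to `[-n, n]`, then dominated convergence: clamping
is 1-Lipschitz, and the generator applied to the full coordinate is the drift. -/
theorem IsLiftedWalk.meanPosition_eq [IsProbabilityMeasure P] (h : IsLiftedWalk r ω v l P Y)
    {j : Fin d} (h0 : Integrable (fun a => (Y 0 a j : ℝ)) P) {t : ℝ} (ht : 0 ≤ t) :
    ∫ a, (Y t.toNNReal a j : ℝ) ∂P = ∫ a, (Y 0 a j : ℝ) ∂P +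
      ∫ s in (0 : ℝ)..t, drift N r ω v l P Y s j := by
  set f : ℕ → (Fin d → ℤ) → ℝ := fun n y => max (-n : ℝ) (min (y j : ℝ) n) with hf
  have hfn : ∀ n y, |f n y| ≤ n := by
    intro n y
    have hn : (0 : ℝ) ≤ n := n.cast_nonneg
    exact abs_le.2 ⟨le_max_left _ _, max_le (by linarith) (min_le_right _ _)⟩
  have hfle : ∀ n y, |f n y| ≤ |(y j : ℝ)| := by
    intro n y
    have hn : (0 : ℝ) ≤ n := n.cast_nonneg
    have h1 := neg_abs_le (y j : ℝ)
    have h2 := le_abs_self (y j : ℝ)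
    have h3 := abs_nonneg (y j : ℝ)
    refine abs_le.2 ⟨le_max_of_le_right (le_min h1 (by linarith)), max_le (by linarith) ?_⟩
    exact (min_le_left _ _).trans h2
  have hflim : ∀ y, Tendsto (fun n => f n y) atTop (𝓝 (y j : ℝ)) := by
    intro y
    refine tendsto_const_nhds.congr' ?_
    filter_upwards [eventually_ge_atTop ⌈|(y j : ℝ)|⌉₊] with n hn
    have h1 := abs_le.1 (Nat.ceil_le.1 hn)
    simp only [hf]
    rw [min_eq_left h1.2, max_eq_right h1.1]
  have hfinc : ∀ n y (e : Direction d), |f n (y + e.vec) - f n y| ≤ 1 := by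
    intro n y e
    refine (abs_max_sub_max_le_max _ _ _ _).trans ?_
    simp only [sub_self, abs_zero]
    refine max_le zero_le_one ((abs_min_sub_min_le_max _ _ _ _).trans ?_)
    simp only [sub_self, abs_zero]
    exact max_le (by simpa using abs_vec_le_one e j) zero_le_one
  have hlim1 : ∀ s, Integrable (fun a => (Y s a j : ℝ)) P →
      Tendsto (fun n => ∫ a, f n (Y s a) ∂P) atTop (𝓝 (∫ a, (Y s a j : ℝ) ∂P)) := by
    intro s hs
    refine tendsto_integral_of_dominated_convergence (fun a => |(Y s a j : ℝ)|) (fun n => ?_)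
      hs.abs (fun n => Eventually.of_forall fun a => hfle n _)
      (Eventually.of_forall fun a => hflim _)
    exact ((Measurable.of_discrete (f := f n)).comp (h.measurable s)).aestronglyMeasurable
  have hlim2 : ∀ s, Tendsto (fun n => ∫ a, liftedGenerator r ω v l s (f n) (Y s.toNNReal a) ∂P)
      atTop (𝓝 (drift N r ω v l P Y s j)) := by
    intro s
    rw [drift, ← integral_comp_proj h.measurable s
      (fun x => ∑ e, perturbed r ω v l s x e * (e.vec j : ℝ))]
    refine tendsto_integral_of_dominated_convergence (fun _ => rateBound r v l * 1) (fun n => ?_)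
      (integrable_const _) (fun n => Eventually.of_forall fun a =>
        abs_liftedGenerator_le r ω v l s (hfinc n) zero_le_one _)
      (Eventually.of_forall fun a => ?_)
    · exact ((Measurable.of_discrete (f := liftedGenerator r ω v l s (f n))).comp
        (h.measurable _)).aestronglyMeasurable
    · refine tendsto_finsetSum _ fun e _ => Tendsto.const_mul _ ?_
      have := (hflim (Y s.toNNReal a + e.vec)).sub (hflim (Y s.toNNReal a))
      simpa using this
  have hlim3 : Tendsto (fun n => ∫ s in (0 : ℝ)..t,
      ∫ a, liftedGenerator r ω v l s (f n) (Y s.toNNReal a) ∂P) atTop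
      (𝓝 (∫ s in (0 : ℝ)..t, drift N r ω v l P Y s j)) := by
    refine intervalIntegral.tendsto_integral_filter_of_dominated_convergence
      (fun _ => rateBound r v l * 1)
      (Eventually.of_forall fun n =>
        (h.measurable_integral_liftedGenerator (f n)).aestronglyMeasurable)
      (Eventually.of_forall fun n => Eventually.of_forall fun s _ => ?_)
      intervalIntegrable_const (Eventually.of_forall fun s _ => hlim2 s)
    have h2 := norm_integral_le_of_norm_le_const (μ := P)
      (f := fun a => liftedGenerator r ω v l s (f n) (Y s.toNNReal a))
      (C := rateBound r v l * 1) (Eventually.of_forall fun a =>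
        abs_liftedGenerator_le r ω v l s (hfinc n) zero_le_one _)
    simpa using h2
  refine tendsto_nhds_unique (hlim1 _ (h.integrable h0 ht)) ?_
  refine ((hlim1 0 h0).add hlim3).congr fun n => ?_
  exact (h.expectation_eq (f := f n) ⟨n, hfn n⟩ ht).symm

theorem IsLiftedWalk.hasDerivWithinAt_meanPosition [IsProbabilityMeasure P]
    (h : IsLiftedWalk r ω v l P Y)
    (h0 : ∀ j, Integrable (fun a => (Y 0 a j : ℝ)) P) {t : ℝ} (ht : 0 ≤ t) :
    HasDerivWithinAt (meanPosition P Y) (drift N r ω v l P Y t) (Ici 0) t := by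
  rw [hasDerivWithinAt_pi]
  intro j
  refine (((continuous_drift h j).integral_hasStrictDerivAt 0 t).hasDerivAt.const_add
    (∫ a, (Y 0 a j : ℝ) ∂P)).hasDerivWithinAt.congr (fun s hs => ?_) ?_
  · exact h.meanPosition_eq (h0 j) hs
  · exact h.meanPosition_eq (h0 j) ht

theorem IsLiftedWalk.meanVelocity_eq [IsProbabilityMeasure P]
    (h : IsLiftedWalk r ω v l P Y)
    (h0 : ∀ j, Integrable (fun a => (Y 0 a j : ℝ)) P) {t : ℝ} (ht : 0 ≤ t) :
    meanVelocity P Y t = drift N r ω v l P Y t :=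
  (h.hasDerivWithinAt_meanPosition h0 ht).derivWithin (uniqueDiffOn_Ici 0 t ht)

theorem IsLiftedWalk.drift_eq [IsProbabilityMeasure P] (h : IsLiftedWalk r ω v l P Y) (t : ℝ)
    (j : Fin d) : drift N r ω v l P Y t j = ∑ e : Direction d,
      (∫ a, perturbed r ω v l t (proj N (Y t.toNNReal a)) e ∂P) * (e.vec j : ℝ) := by
  have h1 : ∀ e : Direction d, ∫ a, perturbed r ω v l t (proj N (Y t.toNNReal a)) e ∂P =
      ∑ x, law N P Y t x * perturbed r ω v l t x e := fun e =>
    integral_comp_proj h.measurable t (fun x => perturbed r ω v l t x e)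
  simp only [h1, drift, Finset.sum_mul, Finset.mul_sum]
  rw [Finset.sum_comm]
  exact Finset.sum_congr rfl fun e _ => Finset.sum_congr rfl fun x _ => by ring

end

end

/-! ### Linear response -/

theorem sum_vec_mul (F : Direction d → ℝ) (j : Fin d) :
    ∑ e, F e * (e.vec j : ℝ) = F (j, 1) - F (j, -1) := by
  rw [sum_direction, Finset.sum_eq_single j]
  · simp [Direction.vec, sub_eq_add_neg]
  · intro i _ hi
    simp [Direction.vec, Pi.single_eq_of_ne hi.symm]
  · simp

section

variable [NeZero N] {r : Rates d N} {p : Torus d N → ℝ} {ω : ℝ} {v : Fin d → ℝ}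

/-- The change of the adjoint generator when the rates `r(x, x + e)` are multiplied by
`1 + α e`. -/
noncomputable def forcing (r : Rates d N) (p : Torus d N → ℝ) (α : Direction d → ℝ)
    (f : Torus d N → ℂ) (x : Torus d N) : ℂ :=
  ∑ e : Direction d, ((reversed r p x e : ℂ) * (α e.opp : ℂ) * f (nbr x e)
    - (r x e : ℂ) * (α e : ℂ) * f x)

/-- A bound on the total rates of the walk and of its time reversal. -/
noncomputable def totalRate (r : Rates d N) (p : Torus d N → ℝ) : ℝ :=
  ∑ x, ∑ e, (reversed r p x e + r x e)

theorem totalRate_nonneg (hr : ∀ x e, 0 < r x e) (hp0 : ∀ x, 0 < p x) : 0 ≤ totalRate r p :=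
  Finset.sum_nonneg fun x _ => Finset.sum_nonneg fun e _ =>
    add_nonneg (reversed_pos hr hp0 x e).le (hr x e).le

theorem norm_forcing_le (hr : ∀ x e, 0 < r x e) (hp0 : ∀ x, 0 < p x) {α : Direction d → ℝ}
    {a b : ℝ} (hα : ∀ e, |α e| ≤ a) (ha : 0 ≤ a) {f : Torus d N → ℂ} (hf : ‖f‖ ≤ b) :
    ‖forcing r p α f‖ ≤ totalRate r p * (a * b) := by
  have hb : 0 ≤ b := (norm_nonneg f).trans hf
  refine (pi_norm_le_iff_of_nonneg (mul_nonneg (totalRate_nonneg hr hp0) (by positivity))).2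
    fun x => ?_
  have h1 : ∑ e, (reversed r p x e + r x e) ≤ totalRate r p :=
    Finset.single_le_sum (f := fun x => ∑ e, (reversed r p x e + r x e))
      (fun x _ => Finset.sum_nonneg fun e _ =>
        add_nonneg (reversed_pos hr hp0 x e).le (hr x e).le) (Finset.mem_univ x)
  refine le_trans ?_ (mul_le_mul_of_nonneg_right h1 (by positivity))
  rw [Finset.sum_mul]
  refine (norm_sum_le _ _).trans (Finset.sum_le_sum fun e _ => (norm_sub_le _ _).trans ?_)
  rw [norm_mul, norm_mul, norm_mul, norm_mul, Complex.norm_real, Complex.norm_real,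
    Complex.norm_real, Complex.norm_real, Real.norm_of_nonneg (reversed_pos hr hp0 x e).le,
    Real.norm_of_nonneg (hr x e).le, add_mul, mul_assoc, mul_assoc]
  refine add_le_add (mul_le_mul_of_nonneg_left ?_ (reversed_pos hr hp0 x e).le)
    (mul_le_mul_of_nonneg_left ?_ (hr x e).le)
  · exact mul_le_mul (hα _) ((norm_le_pi_norm f _).trans hf) (norm_nonneg _) ha
  · exact mul_le_mul (hα _) ((norm_le_pi_norm f _).trans hf) (norm_nonneg _) ha

/-- The function `Ψ · v`. -/
noncomputable def psiDot (r : Rates d N) (p : Torus d N → ℝ) (v : Fin d → ℝ) : Torus d N → ℂ :=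
  ∑ k, (v k : ℂ) • toC (psiFun r p k)

-- The origin of `Ψ`: the first-order effect of the field on the density `1`. Reversed jumps feel
-- the field with the opposite sign, so the gain and loss terms add up.
omit [NeZero N] in
theorem forcing_dot_one (r : Rates d N) (p : Torus d N → ℝ) (v : Fin d → ℝ) :
    forcing r p (fun e => e.dot v) 1 = psiDot r p v := by
  funext x
  have h1 : ∑ e : Direction d, (reversed r p x e * e.opp.dot v - r x e * e.dot v) =
      ∑ k, v k * psiFun r p k x := by
    simp only [psiFun, mul_neg, Finset.mul_sum, ← Finset.sum_neg_distrib]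
    rw [Finset.sum_comm]
    refine Finset.sum_congr rfl fun e _ => ?_
    rw [Direction.dot_opp, mul_neg, ← neg_add', ← add_mul, Direction.dot, Finset.mul_sum,
      ← Finset.sum_neg_distrib]
    exact Finset.sum_congr rfl fun k _ => by ring
  simp only [forcing, psiDot, Finset.sum_apply, Pi.smul_apply, Pi.one_apply, mul_one, smul_eq_mul,
    toC]
  exact_mod_cast h1

-- Splits the error of the linearized forcing into the nonlinear part of `α` acting on `1` and `α`
-- acting on `f - 1`. In the application both are of order `λ²`.
omit [NeZero N] in
theorem forcing_sub_add (r : Rates d N) (p : Torus d N → ℝ) (α β : Direction d → ℝ) (c : ℝ)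
    (f : Torus d N → ℂ) :
    forcing r p α f - (c : ℂ) • forcing r p β 1 =
      forcing r p (fun e => α e - c * β e) 1 + forcing r p α (f - 1) := by
  funext x
  simp only [forcing, Pi.sub_apply, Pi.smul_apply, Pi.add_apply, Pi.one_apply, smul_eq_mul,
    Finset.mul_sum]
  rw [← Finset.sum_sub_distrib, ← Finset.sum_add_distrib]
  refine Finset.sum_congr rfl fun e _ => ?_
  push_cast
  ring

theorem mean_psiDot (hp0 : ∀ x, 0 < p x) : mean p (psiDot r p v) = 0 := by
  have h1 : mean p (psiDot r p v) = ∑ k, (v k : ℂ) * mean p (toC (psiFun r p k)) := by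
    simp only [mean, psiDot, Finset.sum_apply, Pi.smul_apply, smul_eq_mul, Finset.mul_sum]
    rw [Finset.sum_comm]
    exact Finset.sum_congr rfl fun k _ => Finset.sum_congr rfl fun x _ => by ring
  rw [h1]
  exact Finset.sum_eq_zero fun k _ => by rw [mean_psiFun hp0, mul_zero]

/-- The real part of a complex function. -/
noncomputable def rePart (f : Torus d N → ℂ) : Torus d N → ℂ := toC fun x => (f x).re

omit [NeZero N] in
theorem rePart_apply (f : Torus d N → ℂ) (x : Torus d N) : rePart f x = ((f x).re : ℂ) := rfl

theorem adjGenerator_rePart (f : Torus d N → ℂ) :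
    adjGenerator r p (rePart f) = rePart (adjGenerator r p f) := by
  funext x
  rw [rePart_apply, adjGenerator_apply, adjGenerator_apply, Complex.re_sum]
  push_cast
  refine Finset.sum_congr rfl fun e _ => ?_
  rw [Complex.re_ofReal_mul, Complex.sub_re]
  simp [rePart_apply]

theorem mean_rePart (f : Torus d N → ℂ) : mean p (rePart f) = ((mean p f).re : ℂ) := by
  simp only [mean, rePart_apply, Complex.re_sum, Complex.re_ofReal_mul]
  push_cast
  rfl

/-- The amplitude `(iω - L*)⁻¹ (Ψ · v)` of the linear response of the density. -/
noncomputable def amplitude (r : Rates d N) (p : Torus d N → ℝ) (ω : ℝ) (v : Fin d → ℝ) :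
    Torus d N → ℂ :=
  resolvent (adjGenerator r p) (Complex.I * (ω : ℂ)) (psiDot r p v)

/-- The linear response of the density. -/
noncomputable def response (r : Rates d N) (p : Torus d N → ℝ) (ω : ℝ) (v : Fin d → ℝ) (t : ℝ) :
    Torus d N → ℂ :=
  rePart (Complex.exp (Complex.I * ω * t) • amplitude r p ω v)

theorem mean_response (hr : ∀ x e, 0 < r x e) (hp0 : ∀ x, 0 < p x) (hp : IsInvariant r p)
    (hω : ω ≠ 0) (t : ℝ) : mean p (response r p ω v t) = 0 := by
  rw [response, mean_rePart, mean_smul, amplitude, mean_resolvent hp0 hp (by simp [hω])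
    (mem_resolventSet_adjGenerator hr hp0 hp hω) (mean_psiDot hp0)]
  simp

theorem re_exp_I_mul (ω t : ℝ) : (Complex.exp (Complex.I * ω * t)).re = Real.cos (ω * t) := by
  have h : Complex.I * (ω : ℂ) * t = ((ω * t : ℝ) : ℂ) * Complex.I := by push_cast; ring
  rw [h, Complex.exp_ofReal_mul_I_re]

/-- By the resolvent equation, `e^{iωt} w` solves the equation with forcing `e^{iωt} Ψ·v`. Real
parts may be taken because `L*` and `Ψ·v` are real. -/
theorem hasDerivAt_response (hr : ∀ x e, 0 < r x e) (hp0 : ∀ x, 0 < p x) (hp : IsInvariant r p)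
    (hω : ω ≠ 0) (t : ℝ) (x : Torus d N) :
    HasDerivAt (fun s => response r p ω v s x)
      (adjGenerator r p (response r p ω v t) x + (Real.cos (ω * t) : ℂ) * psiDot r p v x) t := by
  set w := amplitude r p ω v with hw
  set E := Complex.exp (Complex.I * ω * t) with hE
  have h1 : HasDerivAt (fun s : ℝ => Complex.exp (Complex.I * ω * s) * w x)
      (E * (Complex.I * ω) * w x) t := by
    have h2 : HasDerivAt (fun s : ℝ => Complex.I * (ω : ℂ) * (s : ℂ)) (Complex.I * ω * 1) t :=
      (Complex.ofRealCLM.hasDerivAt (x := t)).const_mul _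
    rw [mul_one] at h2
    exact h2.cexp.mul_const _
  have h3 : HasDerivAt (fun s : ℝ => (((Complex.exp (Complex.I * ω * s) * w x).re : ℝ) : ℂ))
      (((E * (Complex.I * ω) * w x).re : ℝ) : ℂ) t :=
    (Complex.reCLM.hasFDerivAt.comp_hasDerivAt t h1).ofReal_comp
  have h4 : E * (Complex.I * ω) * w x = (adjGenerator r p (E • w)) x + E * psiDot r p v x := by
    have h5 := congrFun (resolvent_equation (mem_resolventSet_adjGenerator hr hp0 hp hω)
      (psiDot r p v)) x
    rw [map_smul, Pi.smul_apply, smul_eq_mul, ← h5]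
    simp only [Pi.sub_apply, Pi.smul_apply, smul_eq_mul, hw, amplitude]
    ring
  have h6 : psiDot r p v x = ((∑ k, v k * psiFun r p k x : ℝ) : ℂ) := by
    simp [psiDot, toC]
  rw [h4, Complex.add_re, h6, Complex.re_mul_ofReal, hE, re_exp_I_mul] at h3
  rw [response, adjGenerator_rePart, rePart_apply, h6]
  push_cast at h3 ⊢
  exact h3

/-- The density with respect to `p` of the law of the walk on the torus. -/
noncomputable def density {Ω : Type*} [MeasurableSpace Ω] (p : Torus d N → ℝ) (P : Measure Ω)
    (Y : ℝ≥0 → Ω → Fin d → ℤ) (t : ℝ) : Torus d N → ℂ :=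
  toC fun x => law N P Y t x / p x

/-- The forward equation divided by `p x`: the incoming flux `p(x+e) r(x+e,x)` equals `p(x)
r*(x,x+e)`, so the gain term carries the reversed rate and the field factor of `-e`. -/
theorem hasDerivAt_density {Ω : Type*} [MeasurableSpace Ω] {P : Measure Ω} [IsProbabilityMeasure P]
    {Y : ℝ≥0 → Ω → Fin d → ℤ} {l : ℝ} (h : IsLiftedWalk r ω v l P Y)
    (hp0 : ∀ x, 0 < p x) (hp : IsInvariant r p) {t : ℝ} (ht : 0 < t) (x : Torus d N) :
    HasDerivAt (fun s => density p P Y s x) (adjGenerator r p (density p P Y t) x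
      + forcing r p (fun e => Real.exp (l * Real.cos (ω * t) * e.dot v) - 1)
        (density p P Y t) x) t := by
  have h1 := ((h.hasDerivAt_law ht x).div_const (p x)).ofReal_comp
  refine h1.congr_deriv ?_
  have h2 : ∀ y, law N P Y t y = p y * (law N P Y t y / p y) := fun y => by
    field_simp [(hp0 y).ne']
  set b : Torus d N → ℝ := fun y => law N P Y t y / p y with hb
  have h3 : ∀ e : Direction d, law N P Y t (nbr x e) * perturbed r ω v l t (nbr x e) e.opp =
      p x * (reversed r p x e * Real.exp (l * Real.cos (ω * t) * e.opp.dot v) * b (nbr x e)) := by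
    intro e
    rw [h2 (nbr x e), perturbed]
    linear_combination (-b (nbr x e) * Real.exp (l * Real.cos (ω * t) * e.opp.dot v)) *
      mul_reversed (r := r) hp0 x e
  have h4 : (∑ e : Direction d, law N P Y t (nbr x e) * perturbed r ω v l t (nbr x e) e.opp
        - law N P Y t x * ∑ e, perturbed r ω v l t x e) / p x =
      ∑ e : Direction d, reversed r p x e * (b (nbr x e) - b x) +
      ∑ e : Direction d, (reversed r p x e * (Real.exp (l * Real.cos (ω * t) * e.opp.dot v) - 1)
          * b (nbr x e)
        - r x e * (Real.exp (l * Real.cos (ω * t) * e.dot v) - 1) * b x) := by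
    rw [div_eq_iff (hp0 x).ne', Finset.sum_congr rfl fun e _ => h3 e, h2 x, ← Finset.mul_sum]
    have h5 : b x * ∑ e, reversed r p x e = b x * ∑ e, r x e := by rw [sum_reversed hp0 hp]
    have h6 : ∑ e : Direction d, reversed r p x e * (b (nbr x e) - b x) +
        ∑ e : Direction d, (reversed r p x e * (Real.exp (l * Real.cos (ω * t) * e.opp.dot v) - 1)
          * b (nbr x e) - r x e * (Real.exp (l * Real.cos (ω * t) * e.dot v) - 1) * b x) =
        ∑ e : Direction d, reversed r p x e * Real.exp (l * Real.cos (ω * t) * e.opp.dot v)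
          * b (nbr x e) - b x * ∑ e, perturbed r ω v l t x e
          - (b x * ∑ e, reversed r p x e - b x * ∑ e, r x e) := by
      simp only [Finset.mul_sum, perturbed, ← Finset.sum_sub_distrib, ← Finset.sum_add_distrib]
      exact Finset.sum_congr rfl fun e _ => by ring
    rw [h6, h5]
    ring
  rw [h4, adjGenerator_apply, forcing]
  push_cast
  rfl

theorem mean_density {Ω : Type*} [MeasurableSpace Ω] {P : Measure Ω} [IsProbabilityMeasure P]
    {Y : ℝ≥0 → Ω → Fin d → ℤ} (hY : ∀ t, Measurable (Y t)) (hp0 : ∀ x, 0 < p x) (t : ℝ) :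
    mean p (density p P Y t) = 1 := by
  have h1 : ∑ x, p x * (law N P Y t x / p x) = 1 := by
    rw [← sum_law (N := N) (P := P) hY t]
    refine Finset.sum_congr rfl fun x _ => ?_
    field_simp [(hp0 x).ne']
  unfold mean density toC
  exact_mod_cast h1

theorem norm_one_le (d N : ℕ) [NeZero N] : ‖(1 : Torus d N → ℂ)‖ ≤ 1 :=
  (pi_norm_le_iff_of_nonneg zero_le_one).2 fun _ => by simp

theorem adjGenerator_one (r : Rates d N) (p : Torus d N → ℝ) :
    adjGenerator r p (1 : Torus d N → ℂ) = 0 := by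
  funext x; simp [adjGenerator_apply]

/-- The density of the oscillatory steady state is `1 + λ u_t + O(λ²)`, where `u` is the linear
response. -/
theorem exists_density_expansion.{u} (hr : ∀ x e, 0 < r x e) (hp0 : ∀ x, 0 < p x)
    (hp : IsInvariant r p) (hω : ω ≠ 0) (hv : ∑ i, v i ^ 2 = 1) :
    ∃ C : ℝ, ∀ l : ℝ, |l| ≤ 1 → ∀ (Ω : Type u) [MeasurableSpace Ω] (P : Measure Ω)
      [IsProbabilityMeasure P] (Y : ℝ≥0 → Ω → Fin d → ℤ),
      IsOscillatorySteadyState r ω v l P Y → ∀ t, 0 ≤ t →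
        ‖density p P Y t - 1 - (l : ℂ) • response r p ω v t‖ ≤ C * l ^ 2 := by
  obtain ⟨C₀, hC₀, hbound⟩ := exists_periodic_bound hr hp0 hp
  obtain ⟨m, hm, hmp, -⟩ := exists_norm_sq_le_energy hp0
  set M := totalRate r p with hM
  have hM0 : 0 ≤ M := totalRate_nonneg hr hp0
  -- Inside the bracket, `M` comes from the quadratic remainder of the exponential, and the rest
  -- from the `O(λ)` forcing applied to `h - 1`, itself bounded by `C₀ M · 2|λ|/m`.
  refine ⟨C₀ * (M + M * 2 * (C₀ * (M * (2 * (1 / m))))), ?_⟩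
  intro l hl Ω _ P _ Y hY
  have hw := hY.walk
  set T := 2 * Real.pi / |ω| with hT
  have hT0 : 0 < T := by positivity
  set α : ℝ → Direction d → ℝ := fun t e => Real.exp (l * Real.cos (ω * t) * e.dot v) - 1 with hα
  have harg : ∀ t (e : Direction d), |l * Real.cos (ω * t) * e.dot v| ≤ |l| := by
    intro t e
    rw [abs_mul, abs_mul, mul_assoc]
    exact mul_le_of_le_one_right (abs_nonneg _)
      (mul_le_one₀ (Real.abs_cos_le_one _) (abs_nonneg _) (e.abs_dot_le_one v hv))
  have hα1 : ∀ t e, |α t e| ≤ 2 * |l| := fun t e =>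
    (Real.abs_exp_sub_one_le ((harg t e).trans hl)).trans
      (mul_le_mul_of_nonneg_left (harg t e) zero_le_two)
  have hα2 : ∀ t e, |α t e - l * Real.cos (ω * t) * e.dot v| ≤ l ^ 2 := fun t e =>
    (Real.abs_exp_sub_one_sub_id_le ((harg t e).trans hl)).trans (sq_le_sq.2 (harg t e))
  -- A priori bound from `law ≤ 1` and `p ≥ m`; it starts the two-step iteration.
  have hhn : ∀ t, ‖density p P Y t‖ ≤ 1 / m := by
    intro t
    refine (pi_norm_le_iff_of_nonneg (by positivity)).2 fun x => ?_
    change ‖((law N P Y t x / p x : ℝ) : ℂ)‖ ≤ _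
    rw [Complex.norm_real, Real.norm_of_nonneg (div_nonneg (law_nonneg t x) (hp0 x).le)]
    exact div_le_div₀ zero_le_one (law_le_one t x) hm (hmp x)
  have hhc : ∀ x, Continuous fun t => density p P Y t x := fun x =>
    Complex.continuous_ofReal.comp ((continuous_law hw x).div_const _)
  have hhT : density p P Y T = density p P Y 0 := by
    have : ∀ x, law N P Y T x = law N P Y 0 x := by
      intro x
      unfold law Measure.real
      rw [Real.toNNReal_zero, hY.periodic x]
    simp only [density, this]
  have huT : response r p ω v T = response r p ω v 0 := by
    have h1 : Complex.exp (Complex.I * ω * T) = 1 := by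
      rw [Complex.exp_eq_one_iff]
      have habs : (|ω| : ℝ) ≠ 0 := abs_ne_zero.2 hω
      rcases abs_choice ω with h | h
      · refine ⟨1, ?_⟩
        rw [hT, h]
        have : (ω : ℂ) ≠ 0 := Complex.ofReal_ne_zero.2 hω
        push_cast; field_simp
      · refine ⟨-1, ?_⟩
        rw [hT, h]
        have : (ω : ℂ) ≠ 0 := Complex.ofReal_ne_zero.2 hω
        push_cast; field_simp
    simp [response, h1]
  -- First pass: the forcing is `O(λ)` because the density is bounded.
  have hstep1 : ∀ t, 0 ≤ t →
      ‖density p P Y t - 1‖ ≤ C₀ * (M * ((2 * |l|) * (1 / m))) := by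
    refine hbound (fun t => density p P Y t - 1) (fun t => forcing r p (α t) (density p P Y t)) T
      _ hT0 (by positivity) (fun x => ((hhc x).sub continuous_const).continuousOn) ?_ ?_ ?_ ?_
    · intro t ht x
      rw [map_sub, adjGenerator_one, sub_zero]
      exact (hasDerivAt_density hw hp0 hp ht x).sub_const 1
    · intro t _
      exact norm_forcing_le hr hp0 (hα1 t) (by positivity) (hhn t)
    · intro t _
      rw [mean_sub, mean_density hw.measurable hp0, mean_one hp, sub_self]
    · simp only [hhT]
  -- Second pass: after subtraction of the linear response, the remaining forcing is `O(λ²)` by the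
  -- first pass.
  have hstep2 := hbound (fun t => density p P Y t - 1 - (l : ℂ) • response r p ω v t)
    (fun t => forcing r p (α t) (density p P Y t)
      - ((l * Real.cos (ω * t) : ℝ) : ℂ) • forcing r p (fun e => e.dot v) 1) T
    (M * (l ^ 2 * 1) + M * ((2 * |l|) * (C₀ * (M * ((2 * |l|) * (1 / m)))))) hT0 (by positivity)
    (fun x => ?_) ?_ ?_ ?_ ?_
  · intro t ht
    refine (hstep2 t ht).trans (le_of_eq ?_)
    have : |l| * |l| = l ^ 2 := by rw [← sq, sq_abs]
    rw [← this]
    ring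
  · refine (((hhc x).sub continuous_const).sub (continuous_const.mul ?_)).continuousOn
    exact continuous_iff_continuousAt.2 fun t =>
      (hasDerivAt_response hr hp0 hp hω t x).continuousAt
  · intro t ht x
    have h1 := ((hasDerivAt_density hw hp0 hp ht x).sub_const 1).sub
      ((hasDerivAt_response (v := v) hr hp0 hp hω t x).const_mul (l : ℂ))
    rw [map_sub, map_sub, adjGenerator_one, sub_zero, map_smul, forcing_dot_one]
    refine h1.congr_deriv ?_
    simp only [Pi.sub_apply, Pi.smul_apply, smul_eq_mul]
    push_cast
    ring
  · intro t ht
    rw [forcing_sub_add]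
    refine (norm_add_le _ _).trans (add_le_add ?_ ?_)
    · exact norm_forcing_le hr hp0 (hα2 t) (by positivity) (norm_one_le d N)
    · exact norm_forcing_le hr hp0 (hα1 t) (by positivity) (hstep1 t ht.le)
  · intro t _
    rw [mean_sub, mean_sub, mean_density hw.measurable hp0, mean_one hp, mean_smul,
      mean_response hr hp0 hp hω]
    simp
  · simp only [hhT, huT]

/-! ### From the density expansion to the mobility matrix. -/

theorem hasDerivAt_of_abs_sub_le_sq {f : ℝ → ℝ} {f' C : ℝ}
    (h : ∀ l, |l| ≤ 1 → |f l - f 0 - l * f'| ≤ C * l ^ 2) : HasDerivAt f f' 0 := by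
  rw [hasDerivAt_iff_isLittleO_nhds_zero]
  have h1 : (fun l => f (0 + l) - f 0 - l • f') =O[𝓝 0] fun l : ℝ => l ^ 2 := by
    refine Asymptotics.IsBigO.of_bound C ?_
    filter_upwards [Metric.closedBall_mem_nhds (0 : ℝ) one_pos] with l hl
    rw [zero_add, smul_eq_mul, Real.norm_eq_abs, Real.norm_of_nonneg (sq_nonneg l)]
    exact h l (by simpa using hl)
  exact h1.trans_isLittleO (Asymptotics.isLittleO_pow_id one_lt_two)

theorem amplitude_eq_sum (r : Rates d N) (p : Torus d N → ℝ) (ω : ℝ) (v : Fin d → ℝ) :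
    amplitude r p ω v = ∑ k, (v k : ℂ) •
      resolvent (adjGenerator r p) (Complex.I * (ω : ℂ)) (toC (psiFun r p k)) := by
  simp only [amplitude, psiDot, map_sum, map_smul]

theorem scal_toC (p f : Torus d N → ℝ) (h : Torus d N → ℂ) :
    scal p (toC f) h = ∑ x, (p x : ℂ) * ((f x : ℂ) * h x) := by
  simp [scal, toC]

theorem mobility_mulVec (r : Rates d N) (p : Torus d N → ℝ) (ω : ℝ) (v : Fin d → ℝ) (j : Fin d) :
    (mobility r p ω *ᵥ fun k => (v k : ℂ)) j =
      ((∑ x, p x * cFun r j x : ℝ) : ℂ) * v j +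
        scal p (toC (gammaFun r j)) (amplitude r p ω v) := by
  rw [amplitude_eq_sum]
  simp only [Matrix.mulVec, dotProduct, mobility, Matrix.of_apply, add_mul, Finset.sum_add_distrib,
    ite_mul, zero_mul, Finset.sum_ite_eq, Finset.mem_univ, if_true]
  congr 1
  simp only [scal, Finset.sum_apply, Pi.smul_apply, smul_eq_mul, Finset.mul_sum, Finset.sum_mul]
  rw [Finset.sum_comm]
  exact Finset.sum_congr rfl fun x _ => Finset.sum_congr rfl fun k _ => by ring

/-- Product rule for the law times the perturbed drift. The walks for different `λ` need not be
coupled, since only their one-time laws enter. -/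
theorem hasDerivAt_meanVelocity {Ω : ℝ → Type*} [∀ l, MeasurableSpace (Ω l)]
    {P : ∀ l, Measure (Ω l)} [∀ l, IsProbabilityMeasure (P l)]
    {Y : ∀ l, ℝ≥0 → Ω l → Fin d → ℤ}
    (hr : ∀ x e, 0 < r x e) (hp : IsInvariant r p) (hω : ω ≠ 0) (hv : ∑ i, v i ^ 2 = 1)
    (hY : ∀ l, IsOscillatorySteadyState r ω v l (P l) (Y l)) {t : ℝ} (ht : 0 ≤ t) :
    HasDerivAt (fun l => meanVelocity (P l) (Y l) t)
      (fun j => (Complex.exp (Complex.I * ω * t) *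
        (mobility r p ω *ᵥ fun k => (v k : ℂ)) j).re) 0 := by
  have hp0 := hp.pos hr
  have hV : (fun l => meanVelocity (P l) (Y l) t) =
      fun l => drift N r ω v l (P l) (Y l) t := by
    funext l
    exact (hY l).walk.meanVelocity_eq (hY l).integrable_start ht
  rw [hV, hasDerivAt_pi]
  intro j
  obtain ⟨C, hC⟩ := exists_density_expansion hr hp0 hp hω hv
  set E := Complex.exp (Complex.I * ω * t) with hE
  set w := amplitude r p ω v with hw
  have hexp : ∀ l, |l| ≤ 1 → ∀ x,
      |law N (P l) (Y l) t x - p x - l * (p x * (E * w x).re)| ≤ p x * C * l ^ 2 := by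
    intro l hl x
    have h1 := (norm_le_pi_norm _ x).trans (hC l hl (Ω l) (P l) (Y l) (hY l) t ht)
    have h2 : (density p (P l) (Y l) t - 1 - (l : ℂ) • response r p ω v t) x =
        ((law N (P l) (Y l) t x / p x - 1 - l * (E * w x).re : ℝ) : ℂ) := by
      simp [density, toC, response, rePart, ← hE, ← hw]
    rw [h2, Complex.norm_real, Real.norm_eq_abs] at h1
    have h3 : law N (P l) (Y l) t x - p x - l * (p x * (E * w x).re) =
        p x * (law N (P l) (Y l) t x / p x - 1 - l * (E * w x).re) := by
      field_simp [(hp0 x).ne']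
    rw [h3, abs_mul, abs_of_pos (hp0 x), mul_assoc]
    exact mul_le_mul_of_nonneg_left h1 (hp0 x).le
  -- At `λ = 0` the error term vanishes, so the expansion itself identifies the unperturbed law as
  -- `p`.
  have hlaw0 : ∀ x, law N (P 0) (Y 0) t x = p x := by
    intro x
    have h1 := hexp 0 (by simp) x
    simp only [zero_mul, sub_zero, ne_eq, OfNat.ofNat_ne_zero, not_false_eq_true, zero_pow,
      mul_zero, abs_nonpos_iff] at h1
    linarith
  have hlaw : ∀ x, HasDerivAt (fun l => law N (P l) (Y l) t x) (p x * (E * w x).re) 0 := fun x =>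
    hasDerivAt_of_abs_sub_le_sq fun l hl => by rw [hlaw0]; exact hexp l hl x
  have hpert : ∀ x, HasDerivAt (fun l => ∑ e, perturbed r ω v l t x e * (e.vec j : ℝ))
      (∑ e : Direction d, Real.cos (ω * t) * e.dot v * r x e * (e.vec j : ℝ)) 0 := by
    intro x
    refine HasDerivAt.fun_sum fun e _ => HasDerivAt.mul_const ?_ _
    have h1 : HasDerivAt (fun l : ℝ => l * Real.cos (ω * t) * e.dot v)
        (1 * Real.cos (ω * t) * e.dot v) 0 :=
      ((hasDerivAt_id (0 : ℝ)).mul_const _).mul_const _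
    have h2 := h1.exp.mul_const (r x e)
    refine h2.congr_deriv ?_
    simp
  have hsum := HasDerivAt.fun_sum (u := Finset.univ) fun x _ => (hlaw x).mul (hpert x)
  refine hsum.congr_deriv (Eq.symm ?_)
  have hpe : ∀ x, ∑ e, perturbed r ω v 0 t x e * (e.vec j : ℝ) = gammaFun r j x := by
    intro x
    rw [sum_vec_mul]
    simp [perturbed, gammaFun]
  -- The factor `e·v` makes the contributions of `e_j` and `-e_j` add, so `c_j` appears here in
  -- place of `γ_j`.
  have hce : ∀ x, ∑ e : Direction d, Real.cos (ω * t) * e.dot v * r x e * (e.vec j : ℝ) =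
      Real.cos (ω * t) * (cFun r j x * v j) := by
    intro x
    rw [sum_vec_mul, Direction.dot_eq, Direction.dot_eq, cFun]
    push_cast
    ring
  rw [mobility_mulVec, mul_add, Complex.add_re]
  simp only [hpe, hce, hlaw0]
  rw [Finset.sum_add_distrib, add_comm]
  congr 1
  · rw [scal_toC, Finset.mul_sum, Complex.re_sum]
    refine Finset.sum_congr rfl fun x _ => ?_
    have : E * ((p x : ℂ) * ((gammaFun r j x : ℂ) * w x)) =
        ((p x * gammaFun r j x : ℝ) : ℂ) * (E * w x) := by push_cast; ring
    rw [this, Complex.re_ofReal_mul]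
    ring
  · rw [← Complex.ofReal_mul, Complex.re_mul_ofReal, hE, re_exp_I_mul, Finset.sum_mul,
      Finset.mul_sum]
    exact Finset.sum_congr rfl fun x _ => by ring

/-! ### The reversible case -/

omit [NeZero N] in
theorem psiFun_of_reversible (h : IsReversible r p) (k : Fin d) (x : Torus d N) :
    psiFun r p k x = -2 * gammaFun r k x := by
  have h' : reversed r p = r := h
  rw [psiFun, h', sum_vec_mul (fun e => r x e + r x e), gammaFun]
  ring

theorem adjGenerator_of_reversible (h : IsReversible r p) : adjGenerator r p = generator r := by
  have h' : reversed r p = r := h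
  rw [adjGenerator, h']

omit [NeZero N] in
theorem toC_psiFun_of_reversible (h : IsReversible r p) (k : Fin d) :
    toC (psiFun r p k) = (-2 : ℂ) • toC (gammaFun r k) := by
  funext x
  simp [toC, psiFun_of_reversible h]

theorem scal_smul (p : Torus d N → ℝ) (f h : Torus d N → ℂ) (a : ℂ) :
    scal p f (a • h) = a * scal p f h := by
  simp only [scal, Pi.smul_apply, smul_eq_mul, Finset.mul_sum]
  exact Finset.sum_congr rfl fun x _ => by ring

/-- Detailed balance and edge reversal. The pairing is bilinear, without conjugation, which is what
makes `σ` symmetric and not Hermitian. -/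
theorem sum_mul_generator_comm (hp0 : ∀ x, 0 < p x) (h : IsReversible r p)
    (f g : Torus d N → ℂ) :
    ∑ x, (p x : ℂ) * (f x * generator r g x) = ∑ x, (p x : ℂ) * (generator r f x * g x) := by
  have h' : reversed r p = r := h
  have hexp : ∀ f g : Torus d N → ℂ, ∑ x, (p x : ℂ) * (f x * generator r g x) =
      ∑ x, ∑ e : Direction d, (p x : ℂ) * r x e * (f x * g (nbr x e))
        - ∑ x, ∑ e, (p x : ℂ) * r x e * (f x * g x) := by
    intro f g
    rw [← Finset.sum_sub_distrib]
    refine Finset.sum_congr rfl fun x _ => ?_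
    rw [generator_apply, Finset.mul_sum, Finset.mul_sum, ← Finset.sum_sub_distrib]
    exact Finset.sum_congr rfl fun e _ => by ring
  have hcomm : ∑ x, (p x : ℂ) * (generator r f x * g x) =
      ∑ x, (p x : ℂ) * (g x * generator r f x) :=
    Finset.sum_congr rfl fun x _ => by rw [mul_comm (generator r f x)]
  rw [hcomm, hexp, hexp]
  congr 1
  · rw [← sum_edgeReversal fun x e => (p x : ℂ) * r x e * (f x * g (nbr x e))]
    refine Finset.sum_congr rfl fun x _ => Finset.sum_congr rfl fun e _ => ?_
    have h1 := mul_reversed (r := r) hp0 x e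
    rw [h'] at h1
    rw [nbr_nbr_opp, ← Complex.ofReal_mul, ← h1]
    push_cast
    ring
  · exact Finset.sum_congr rfl fun x _ => Finset.sum_congr rfl fun e _ => by ring

/-- For real `f` and `g` the scalar product is the bilinear pairing. Writing `f = (z - L)F` and `g =
(z - L)G` reduces the claim to the symmetry of `L` in that pairing. -/
theorem scal_resolvent_comm (hp0 : ∀ x, 0 < p x) (h : IsReversible r p) {z : ℂ}
    (hz : z ∈ resolventSet ℂ (generator r)) (f g : Torus d N → ℝ) :
    scal p (toC f) (resolvent (generator r) z (toC g)) =
      scal p (toC g) (resolvent (generator r) z (toC f)) := by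
  set F := resolvent (generator r) z (toC f) with hF
  set G := resolvent (generator r) z (toC g) with hG
  have h1 : ∀ x, (f x : ℂ) = z * F x - generator r F x := fun x =>
    (congrFun (resolvent_equation hz (toC f)) x).symm
  have h2 : ∀ x, (g x : ℂ) = z * G x - generator r G x := fun x =>
    (congrFun (resolvent_equation hz (toC g)) x).symm
  have h3 := sum_mul_generator_comm hp0 h F G
  rw [scal_toC, scal_toC]
  simp only [h1, h2, sub_mul, mul_sub, Finset.sum_sub_distrib]
  congr 1
  · exact Finset.sum_congr rfl fun x _ => by ring
  · rw [← h3]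
    exact Finset.sum_congr rfl fun x _ => by ring

theorem mobility_of_reversible (h : IsReversible r p) (ω : ℝ) (j k : Fin d) :
    mobility r p ω j k = (if j = k then ((∑ x, p x * cFun r j x : ℝ) : ℂ) else 0) -
      2 * scal p (toC (gammaFun r j))
        (resolvent (generator r) (Complex.I * (ω : ℂ)) (toC (gammaFun r k))) := by
  rw [mobility, Matrix.of_apply, toC_psiFun_of_reversible h, adjGenerator_of_reversible h,
    map_smul, scal_smul]
  ring

theorem mobility_isSymm (hr : ∀ x e, 0 < r x e) (hp : IsInvariant r p) (hω : ω ≠ 0)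
    (h : IsReversible r p) : (mobility r p ω).IsSymm := by
  have hp0 := hp.pos hr
  have hz := mem_resolventSet_adjGenerator hr hp0 hp hω
  rw [adjGenerator_of_reversible h] at hz
  refine Matrix.IsSymm.ext fun j k => ?_
  rw [mobility_of_reversible h, mobility_of_reversible h, scal_resolvent_comm hp0 h hz]
  congr 1
  by_cases hjk : j = k
  · subst hjk; rfl
  · rw [if_neg hjk, if_neg (Ne.symm hjk)]

/-- Inherited from `Ψ_k = -2γ_k`; it makes the Laplace representation available for `γ_k` itself. -/
theorem mean_gammaFun_of_reversible (hp0 : ∀ x, 0 < p x) (h : IsReversible r p) (k : Fin d) :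
    mean p (toC (gammaFun r k)) = 0 := by
  have h1 := mean_psiFun (r := r) hp0 k
  rw [toC_psiFun_of_reversible h, mean_smul] at h1
  exact (mul_eq_zero.1 h1).resolve_left (by norm_num)

end

end TorusWalk

/-! ### The main theorem. -/

theorem mainTheorem6 (d N : ℕ) [NeZero N]
    (r : TorusWalk.Rates d N) (hr : ∀ x e, 0 < r x e)
    (p : TorusWalk.Torus d N → ℝ) (hp : TorusWalk.IsInvariant r p)
    (ω : ℝ) (hω : ω ≠ 0) :
    -- linear response of the mean velocity in the oscillatory steady state
    (∀ v : Fin d → ℝ, ∑ i, v i ^ 2 = 1 →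
      ∀ (Ω : ℝ → Type*) [∀ l, MeasurableSpace (Ω l)]
        (P : ∀ l, Measure (Ω l)) [∀ l, IsProbabilityMeasure (P l)]
        (Y : ∀ l, ℝ≥0 → Ω l → Fin d → ℤ),
      (∀ l, TorusWalk.IsOscillatorySteadyState r ω v l (P l) (Y l)) →
        (∀ l (t : ℝ), 0 ≤ t →
          (∀ j, Integrable (fun a => (Y l t.toNNReal a j : ℝ)) (P l)) ∧
          DifferentiableWithinAt ℝ (TorusWalk.meanPosition (P l) (Y l)) (Ici 0) t ∧
          ∀ j, TorusWalk.meanVelocity (P l) (Y l) t j =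
            ∑ e : TorusWalk.Direction d,
              (∫ a, TorusWalk.perturbed r ω v l t
                (TorusWalk.proj N (Y l t.toNNReal a)) e ∂(P l)) * (e.vec j : ℝ)) ∧
        (∀ t : ℝ, 0 ≤ t →
          HasDerivAt (fun l => TorusWalk.meanVelocity (P l) (Y l) t)
            (fun j => (Complex.exp (Complex.I * ω * t) *
              (TorusWalk.mobility r p ω *ᵥ fun k => (v k : ℂ)) j).re) 0)) ∧
    -- the operator `iω - L*` is invertible, and the integral form of the mobility matrix
    (Complex.I * (ω : ℂ) ∈ resolventSet ℂ (TorusWalk.adjGenerator r p)) ∧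
    (∀ j k,
      IntegrableOn (TorusWalk.laplaceIntegrand p (TorusWalk.adjGenerator r p) ω
        (TorusWalk.toC (TorusWalk.gammaFun r j)) (TorusWalk.toC (TorusWalk.psiFun r p k)))
        (Ioi 0) ∧
      TorusWalk.mobility r p ω j k =
        (if j = k then ((∑ x, p x * TorusWalk.cFun r j x : ℝ) : ℂ) else 0) +
          ∫ s in Ioi (0 : ℝ), TorusWalk.laplaceIntegrand p (TorusWalk.adjGenerator r p) ω
            (TorusWalk.toC (TorusWalk.gammaFun r j))
            (TorusWalk.toC (TorusWalk.psiFun r p k)) s) ∧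
    -- the reversible case
    (TorusWalk.IsReversible r p →
      (∀ k x, TorusWalk.psiFun r p k x = -2 * TorusWalk.gammaFun r k x) ∧
      TorusWalk.adjGenerator r p = TorusWalk.generator r ∧
      (TorusWalk.mobility r p ω).IsSymm ∧
      (∀ j k,
        TorusWalk.mobility r p ω j k =
          (if j = k then ((∑ x, p x * TorusWalk.cFun r j x : ℝ) : ℂ) else 0) -
            2 * TorusWalk.scal p (TorusWalk.toC (TorusWalk.gammaFun r j))
              (resolvent (TorusWalk.generator r) (Complex.I * (ω : ℂ))
                (TorusWalk.toC (TorusWalk.gammaFun r k))) ∧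
        IntegrableOn (TorusWalk.laplaceIntegrand p (TorusWalk.generator r) ω
          (TorusWalk.toC (TorusWalk.gammaFun r j)) (TorusWalk.toC (TorusWalk.gammaFun r k)))
          (Ioi 0) ∧
        TorusWalk.mobility r p ω j k =
          (if j = k then ((∑ x, p x * TorusWalk.cFun r j x : ℝ) : ℂ) else 0) -
            2 * ∫ s in Ioi (0 : ℝ), TorusWalk.laplaceIntegrand p (TorusWalk.generator r) ω
              (TorusWalk.toC (TorusWalk.gammaFun r j))
              (TorusWalk.toC (TorusWalk.gammaFun r k)) s)) := by
  have hp0 := hp.pos hr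
  refine ⟨fun v hv Ω _ P _ Y hY => ⟨fun l t ht => ⟨fun j => ?_, ?_, fun j => ?_⟩,
    fun t ht => TorusWalk.hasDerivAt_meanVelocity hr hp hω hv hY ht⟩,
    TorusWalk.mem_resolventSet_adjGenerator hr hp0 hp hω, fun j k => ?_, fun hrev => ?_⟩
  · exact (hY l).walk.integrable ((hY l).integrable_start j) ht
  · exact ((hY l).walk.hasDerivWithinAt_meanPosition
      (hY l).integrable_start ht).differentiableWithinAt
  · rw [(hY l).walk.meanVelocity_eq (hY l).integrable_start ht, (hY l).walk.drift_eq]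
  · have h := TorusWalk.laplace_resolvent hr hp0 hp hω (TorusWalk.toC (TorusWalk.gammaFun r j))
      (TorusWalk.mean_psiFun (r := r) hp0 k)
    refine ⟨h.1, ?_⟩
    rw [← h.2]
    rfl
  · have hA := TorusWalk.adjGenerator_of_reversible hrev
    refine ⟨TorusWalk.psiFun_of_reversible hrev, hA, TorusWalk.mobility_isSymm hr hp hω hrev,
      fun j k => ?_⟩
    have h := TorusWalk.laplace_resolvent hr hp0 hp hω (TorusWalk.toC (TorusWalk.gammaFun r j))
      (TorusWalk.mean_gammaFun_of_reversible hp0 hrev k)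
    rw [hA] at h
    refine ⟨TorusWalk.mobility_of_reversible hrev ω j k, h.1, ?_⟩
    rw [← h.2]
    exact TorusWalk.mobility_of_reversible hrev ω j k
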